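/- Let $M$ be a connected, Hausdorff, second countable smooth manifold of dimension $n+1$, with a smooth Lorentzian metric $g$ of signature $(-,+,\dots,+)$ and a time orientation. A hypersurface of $M$ is a smooth embedded submanifold of codimension $1$ without boundary; it is spacelike if $g$ is positive definite on its tangent spaces. If $\nu$ is the future-pointing unit normal field of a spacelike hypersurface $\Sigma$ and $\nabla$ the Levi-Civita connection of $g$, the mean curvature of $\Sigma$ at $p$ is the trace (with respect to $g|_{T_p\Sigma}$) of the second fundamental form $II_p(X,Y)=-g(\nabla_X \nu,Y)$ on $T_p\Sigma$; $\Sigma$ is CMC if its mean curvature is constant. A Cauchy surface is a spacelike hypersurface that every inextendible non-spacelike curve meets exactly once. A CMC time function is a smooth submersion $\tau:M\to\mathbb{R}$ that is strictly increasing along every future-directed timelike curve and such that, for every $\theta\in\mathbb{R}$, the (possibly empty) fiber $\tau^{-1}(\theta)$ is a spacelike hypersurface of constant mean curvature $\theta$. Proposition. Assume that $M$ has a compact Cauchy surface (that is, $M$ is globally hyperbolic with compact Cauchy surfaces), and let $\tau:M\to\mathbb{R}$ be a CMC time function. Then every nonempty compact CMC spacelike hypersurface $\Sigma$ of $M$ is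 a fiber of $\tau$: there is $\theta\in\mathbb{R}$ with $\Sigma=\tau^{-1}(\theta)$. -/

import Mathlib

open Set Filter Topology Bundle Manifold
open scoped Manifold ContDiff

noncomputable section

namespace Spacetime

/-- The model space of an `(n + 1)`-dimensional manifold. -/
abbrev Model (n : ℕ) : Type := EuclideanSpace ℝ (Fin (n + 1))

/-- A smooth Lorentzian metric, of signature `(-, +, …, +)`, on an `(n + 1)`-dimensional manifold:
a smooth field of symmetric bilinear forms, each of which is negative on some vector `v` and
positive definite on the orthogonal complement of `v`. -/
structure LorentzianMetric (n : ℕ) (M : Type*) [TopologicalSpace M]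
    [ChartedSpace (Model n) M] [IsManifold (𝓡 (n + 1)) ∞ M] where
  val (p : M) : TangentSpace (𝓡 (n + 1)) p →L[ℝ] TangentSpace (𝓡 (n + 1)) p →L[ℝ] ℝ
  symm (p : M) (v w : TangentSpace (𝓡 (n + 1)) p) : val p v w = val p w v
  signature (p : M) : ∃ v : TangentSpace (𝓡 (n + 1)) p, val p v v < 0 ∧
    ∀ w : TangentSpace (𝓡 (n + 1)) p, val p v w = 0 → w ≠ 0 → 0 < val p w w
  contMDiff : ContMDiff (𝓡 (n + 1))
    ((𝓡 (n + 1)).prod 𝓘(ℝ, Model n →L[ℝ] Model n →L[ℝ] ℝ)) ∞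
    (fun p : M ↦ TotalSpace.mk' (Model n →L[ℝ] Model n →L[ℝ] ℝ)
      (E := fun q : M ↦ TangentSpace (𝓡 (n + 1)) q →L[ℝ] TangentSpace (𝓡 (n + 1)) q →L[ℝ] ℝ)
      p (val p))

variable {n : ℕ} {M : Type*} [TopologicalSpace M]
  [ChartedSpace (Model n) M] [IsManifold (𝓡 (n + 1)) ∞ M]

/-- A time orientation, given by a smooth timelike vector field. -/
structure TimeOrientation (g : LorentzianMetric n M) where
  field (p : M) : TangentSpace (𝓡 (n + 1)) p
  timelike (p : M) : g.val p (field p) (field p) < 0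
  contMDiff : ContMDiff (𝓡 (n + 1)) (𝓡 (n + 1)).tangent ∞
    (fun p : M ↦ (⟨p, field p⟩ : TangentBundle (𝓡 (n + 1)) M))

/-- A vector is timelike if `g(v, v) < 0`. -/
def IsTimelike (g : LorentzianMetric n M) {p : M} (v : TangentSpace (𝓡 (n + 1)) p) : Prop :=
  g.val p v v < 0

/-- A vector is causal (non-spacelike) if it is nonzero and `g(v, v) ≤ 0`. -/
def IsCausal (g : LorentzianMetric n M) {p : M} (v : TangentSpace (𝓡 (n + 1)) p) : Prop :=
  v ≠ 0 ∧ g.val p v v ≤ 0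

/-- A causal vector is future directed if it lies in the same half of the causal cone as the
field `T` giving the time orientation, that is, if `g(v, T) < 0`. -/
def IsFutureDirected {g : LorentzianMetric n M} (T : TimeOrientation g) {p : M}
    (v : TangentSpace (𝓡 (n + 1)) p) : Prop :=
  g.val p v (T.field p) < 0

/-! ### Curves -/

/-- The velocity `γ'(t)` of a curve. -/
def velocity (n : ℕ) {M : Type*} [TopologicalSpace M] [ChartedSpace (Model n) M]
    (γ : ℝ → M) (t : ℝ) : TangentSpace (𝓡 (n + 1)) (γ t) :=
  mfderiv 𝓘(ℝ, ℝ) (𝓡 (n + 1)) γ t (1 : ℝ)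

/-- `γ`, restricted to `I`, is a `C¹` curve parametrized by a nonempty open interval. -/
structure IsCurveOn (n : ℕ) {M : Type*} [TopologicalSpace M] [ChartedSpace (Model n) M]
    (γ : ℝ → M) (I : Set ℝ) : Prop where
  isOpen : IsOpen I
  ordConnected : I.OrdConnected
  nonempty : I.Nonempty
  contMDiffOn : ContMDiffOn 𝓘(ℝ, ℝ) (𝓡 (n + 1)) 1 γ I

/-- A causal (non-spacelike) curve. -/
def IsCausalCurve (g : LorentzianMetric n M) (γ : ℝ → M) (I : Set ℝ) : Prop :=
  IsCurveOn n γ I ∧ ∀ t ∈ I, IsCausal g (velocity n γ t)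

/-- A future-directed timelike curve. -/
def IsFutureTimelikeCurve {g : LorentzianMetric n M} (T : TimeOrientation g)
    (γ : ℝ → M) (I : Set ℝ) : Prop :=
  IsCurveOn n γ I ∧
    ∀ t ∈ I, IsTimelike g (velocity n γ t) ∧ IsFutureDirected T (velocity n γ t)

/-- A curve parametrized by an open interval is inextendible if it has no endpoint in `M`, that is,
no limit as the parameter tends to the upper end or to the lower end of the interval. -/
def IsInextendible {M : Type*} [TopologicalSpace M] (γ : ℝ → M) (I : Set ℝ) : Prop :=
  (¬ ∃ p : M, Tendsto (fun t : I ↦ γ t) atTop (𝓝 p)) ∧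
    ¬ ∃ p : M, Tendsto (fun t : I ↦ γ t) atBot (𝓝 p)

/-! ### Hypersurfaces -/

/-- `S` is a smooth embedded hypersurface (without boundary): near each of its points it is the
zero set of a smooth function with nonvanishing differential. -/
def IsHypersurface (n : ℕ) {M : Type*} [TopologicalSpace M] [ChartedSpace (Model n) M]
    (S : Set M) : Prop :=
  ∀ p ∈ S, ∃ (U : Set M) (f : M → ℝ), IsOpen U ∧ p ∈ U ∧
    ContMDiffOn (𝓡 (n + 1)) 𝓘(ℝ, ℝ) ∞ f U ∧
    (∀ q ∈ U, q ∈ S ↔ f q = 0) ∧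
    ∀ q ∈ U, mfderiv (𝓡 (n + 1)) 𝓘(ℝ, ℝ) f q ≠ 0

/-- The vector `v` belongs to the tangent space `T_p S`: it is annihilated by the differential at
`p` of every function that is smooth at `p` and vanishes on `S` near `p`. -/
def IsTangentTo (S : Set M) {p : M} (v : TangentSpace (𝓡 (n + 1)) p) : Prop :=
  ∀ f : M → ℝ, ContMDiffAt (𝓡 (n + 1)) 𝓘(ℝ, ℝ) ∞ f p → (∀ᶠ q in 𝓝[S] p, f q = 0) →
    mfderiv (𝓡 (n + 1)) 𝓘(ℝ, ℝ) f p v = (0 : ℝ)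

/-- A spacelike hypersurface: the metric is positive definite on each of its tangent spaces. -/
def IsSpacelikeHypersurface (g : LorentzianMetric n M) (S : Set M) : Prop :=
  IsHypersurface n S ∧
    ∀ p ∈ S, ∀ v : TangentSpace (𝓡 (n + 1)) p, IsTangentTo S v → v ≠ 0 → 0 < g.val p v v

/-- A Cauchy surface: a spacelike hypersurface that every inextendible causal curve meets
exactly once. -/
def IsCauchySurface (g : LorentzianMetric n M) (S : Set M) : Prop :=
  IsSpacelikeHypersurface g S ∧
    ∀ (γ : ℝ → M) (I : Set ℝ), IsCausalCurve g γ I → IsInextendible γ I → ∃! t, t ∈ I ∧ γ t ∈ S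

/-! ### The Levi-Civita connection and the mean curvature -/

/-- The metric in the chart `φ` at `p`: the number `g(dφ⁻¹ u, dφ⁻¹ v)` at the point with
coordinates `x`. -/
def metricInChart (g : LorentzianMetric n M) (p : M) (x u v : Model n) : ℝ :=
  g.val ((extChartAt (𝓡 (n + 1)) p).symm x)
    (mfderiv 𝓘(ℝ, Model n) (𝓡 (n + 1)) (extChartAt (𝓡 (n + 1)) p).symm x u)
    (mfderiv 𝓘(ℝ, Model n) (𝓡 (n + 1)) (extChartAt (𝓡 (n + 1)) p).symm x v)

/-- The Christoffel symbols of the first kind at `p`, in the chart at `p`: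
`(∂_u g(v, w) + ∂_v g(u, w) - ∂_w g(u, v)) / 2`. -/
def christoffel (g : LorentzianMetric n M) (p : M) (u v w : Model n) : ℝ :=
  (fderiv ℝ (fun x ↦ metricInChart g p x v w) (extChartAt (𝓡 (n + 1)) p p) u
    + fderiv ℝ (fun x ↦ metricInChart g p x u w) (extChartAt (𝓡 (n + 1)) p p) v
    - fderiv ℝ (fun x ↦ metricInChart g p x u v) (extChartAt (𝓡 (n + 1)) p p) w) / 2

/-- The coordinates of a tangent vector at `q` in the chart at `p`. -/
def vectorInChart (p : M) {q : M} (v : TangentSpace (𝓡 (n + 1)) q) : Model n :=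
  mfderiv (𝓡 (n + 1)) 𝓘(ℝ, Model n) (extChartAt (𝓡 (n + 1)) p) q v

/-- The vector field `N` in the chart at `p`. -/
def fieldInChart (N : ∀ q : M, TangentSpace (𝓡 (n + 1)) q) (p : M) (x : Model n) : Model n :=
  vectorInChart p (N ((extChartAt (𝓡 (n + 1)) p).symm x))

/-- The number `g(∇_X N, Y)` at `p`, where `∇` is the Levi-Civita connection of `g`, computed in
the chart at `p`: with coordinates `u`, `w` of `X`, `Y` it is `g(∂_u N, w) + Γ(u, N, w)`. -/
def covDeriv (g : LorentzianMetric n M) (N : ∀ q : M, TangentSpace (𝓡 (n + 1)) q) (p : M)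
    (X Y : TangentSpace (𝓡 (n + 1)) p) : ℝ :=
  metricInChart g p (extChartAt (𝓡 (n + 1)) p p)
      (fderiv ℝ (fieldInChart N p) (extChartAt (𝓡 (n + 1)) p p) (vectorInChart p X))
      (vectorInChart p Y)
    + christoffel g p (vectorInChart p X) (vectorInChart p (N p)) (vectorInChart p Y)

/-- `N` is a smooth vector field on the open set `U` whose restriction to `S ∩ U` is the
future-pointing unit normal vector field of `S`. -/
structure IsFutureUnitNormalOn {g : LorentzianMetric n M} (T : TimeOrientation g) (S U : Set M)
    (N : ∀ q : M, TangentSpace (𝓡 (n + 1)) q) : Prop where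
  isOpen : IsOpen U
  contMDiffOn : ContMDiffOn (𝓡 (n + 1)) (𝓡 (n + 1)).tangent ∞
    (fun q : M ↦ (⟨q, N q⟩ : TangentBundle (𝓡 (n + 1)) M)) U
  unit : ∀ q ∈ S ∩ U, g.val q (N q) (N q) = -1
  future : ∀ q ∈ S ∩ U, IsFutureDirected T (N q)
  normal : ∀ q ∈ S ∩ U, ∀ v : TangentSpace (𝓡 (n + 1)) q, IsTangentTo S v → g.val q (N q) v = 0

/-- The second fundamental form `II(X, Y) = -g(∇_X N, Y)`, for `N` a local extension of the
future-pointing unit normal field; on tangent vectors of the hypersurface it does not depend on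
the extension. -/
def secondFundamentalForm (g : LorentzianMetric n M) (N : ∀ q : M, TangentSpace (𝓡 (n + 1)) q)
    (p : M) (X Y : TangentSpace (𝓡 (n + 1)) p) : ℝ :=
  -covDeriv g N p X Y

/-- The spacelike hypersurface `S` has mean curvature `H` at `p`: `H` is the trace of the second
fundamental form, that is `∑ i, II(e i, e i)` for an orthonormal basis `e` of `T_p S`. -/
def HasMeanCurvatureAt {g : LorentzianMetric n M} (T : TimeOrientation g) (S : Set M) (p : M)
    (H : ℝ) : Prop :=
  ∃ (U : Set M) (N : ∀ q : M, TangentSpace (𝓡 (n + 1)) q)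
    (e : Fin n → TangentSpace (𝓡 (n + 1)) p),
    p ∈ U ∧ IsFutureUnitNormalOn T S U N ∧
    (∀ i, IsTangentTo S (e i)) ∧
    (∀ i j, g.val p (e i) (e j) = if i = j then 1 else 0) ∧
    H = ∑ i, secondFundamentalForm g N p (e i) (e i)

/-- `S` is a spacelike hypersurface of constant mean curvature `c`. -/
def HasConstantMeanCurvature {g : LorentzianMetric n M} (T : TimeOrientation g) (S : Set M)
    (c : ℝ) : Prop :=
  IsSpacelikeHypersurface g S ∧ ∀ p ∈ S, HasMeanCurvatureAt T S p c

/-! ### Time functions -/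

/-- A time function: a smooth submersion to `ℝ` that is strictly increasing along every
future-directed timelike curve. -/
def IsTimeFunction {g : LorentzianMetric n M} (T : TimeOrientation g) (τ : M → ℝ) : Prop :=
  IsSubmersion (𝓡 (n + 1)) 𝓘(ℝ, ℝ) ∞ τ ∧
    ∀ (γ : ℝ → M) (I : Set ℝ), IsFutureTimelikeCurve T γ I → StrictMonoOn (τ ∘ γ) I

/-- A CMC time function: a time function whose fiber over each `θ` is a (possibly empty)
spacelike hypersurface of constant mean curvature `θ`. -/
def IsCMCTimeFunction {g : LorentzianMetric n M} (T : TimeOrientation g) (τ : M → ℝ) : Prop :=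
  IsTimeFunction T τ ∧ ∀ θ : ℝ, HasConstantMeanCurvature T (τ ⁻¹' {θ}) θ

end Spacetime

end

noncomputable section

set_option linter.unusedSectionVars false

namespace Spacetime

section ChartCalculus

variable {n : ℕ} {M : Type*} [TopologicalSpace M]
  [ChartedSpace (Model n) M] [IsManifold (𝓡 (n + 1)) ∞ M]

/-! ### Calculus in the chart at a point -/

/-! On the compact set `S` the function `τ` has a maximum at some `p` and a minimum at some `q`. At
`p` the hypersurface `S` touches the fiber of `τ` through `p` from the past, so its mean curvature
`c` is at least that of the fiber, which is `τ p`; symmetrically `c ≤ τ q`. Hence `max τ ≤ c ≤ min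
τ` on `S`, and `S` lies in the fiber over `c`
(`IsCMCTimeFunction.eq_of_mem_of_hasConstantMeanCurvature`). Since the value of `τ` on a fiber is
its mean curvature, the weak comparison at one point suffices; no strong maximum principle is used.

The comparison (`HasMeanCurvatureAt.exists_sub_eq`) takes place in one chart. If `f` and `k` define
two hypersurfaces tangent at `p`, then `dk = κ df` there and the unit normals agree, so the
Christoffel terms cancel. The difference of mean curvatures is a positive multiple of the trace of
`κ D²f - D²k` on the tangent space. At an extremum of `k` on `f = 0` the sign of this form is the
second order Lagrange condition (`snd_fderiv_le_of_isLocalMaxOn`).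

For the reverse inclusion, the orbits of the timelike field `T` are inextendible causal curves, so
each meets the Cauchy surface `C` once, which gives a continuous projection `r : M → C`. The union
of the orbits that meet `S` is `r ⁻¹' (r '' S)`. It is closed because `r '' S` is compact, and open
because `T` is transverse to `S`; by connectedness it is all of `M`
(`IsCauchySurface.exists_sameOrbit`). A point of the fiber over `c` therefore shares an orbit with a
point of `S` having the same value of `τ`; as `τ` strictly increases along orbits, the two points
coincide. -/

theorem mdifferentiableAt_chart_symm {p : M} {x : Model n}
    (hx : x ∈ (extChartAt (𝓡 (n + 1)) p).target) :
    MDifferentiableAt 𝓘(ℝ, Model n) (𝓡 (n + 1)) (extChartAt (𝓡 (n + 1)) p).symm x := by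
  have h := mdifferentiableWithinAt_extChartAt_symm (I := 𝓡 (n + 1)) hx
  rwa [ModelWithCorners.range_eq_univ, mdifferentiableWithinAt_univ] at h

theorem mfderiv_chart_symm_apply_mfderiv_chart {p : M} {x : Model n}
    (hx : x ∈ (extChartAt (𝓡 (n + 1)) p).target)
    (v : TangentSpace (𝓡 (n + 1)) ((extChartAt (𝓡 (n + 1)) p).symm x)) :
    mfderiv 𝓘(ℝ, Model n) (𝓡 (n + 1)) (extChartAt (𝓡 (n + 1)) p).symm x (vectorInChart p v) = v := by
  have h := mfderivWithin_extChartAt_symm_comp_mfderiv_extChartAt (I := 𝓡 (n + 1)) hx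
  rw [ModelWithCorners.range_eq_univ, mfderivWithin_univ] at h
  exact congrArg (fun A : TangentSpace (𝓡 (n + 1)) ((extChartAt (𝓡 (n + 1)) p).symm x) →L[ℝ]
    TangentSpace (𝓡 (n + 1)) ((extChartAt (𝓡 (n + 1)) p).symm x) => A v) h

theorem vectorInChart_self {p : M} (v : TangentSpace (𝓡 (n + 1)) p) : vectorInChart p v = v := by
  have h := mfderiv_extChartAt_self (I := 𝓡 (n + 1)) (x := p)
  exact congrArg (fun A : Model n →L[ℝ] Model n => A v) h

theorem chart_target_mem_nhds {p : M} {x : Model n}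
    (hx : x ∈ (extChartAt (𝓡 (n + 1)) p).target) : (extChartAt (𝓡 (n + 1)) p).target ∈ 𝓝 x :=
  (isOpen_extChartAt_target p).mem_nhds hx

/-- The metric in the chart at `p`, as a field of bilinear forms. -/
def chartMetric (g : LorentzianMetric n M) (p : M) (x : Model n) : Model n →L[ℝ] Model n →L[ℝ] ℝ :=
  let A : Model n →L[ℝ] Model n :=
    mfderiv 𝓘(ℝ, Model n) (𝓡 (n + 1)) (extChartAt (𝓡 (n + 1)) p).symm x
  let B : Model n →L[ℝ] Model n →L[ℝ] ℝ := g.val ((extChartAt (𝓡 (n + 1)) p).symm x)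
  B.bilinearComp A A

theorem chartMetric_apply (g : LorentzianMetric n M) (p : M) (x u v : Model n) :
    chartMetric g p x u v = metricInChart g p x u v := rfl

theorem metricInChart_self (g : LorentzianMetric n M) (p : M) (v w : TangentSpace (𝓡 (n + 1)) p) :
    metricInChart g p (extChartAt (𝓡 (n + 1)) p p) v w = g.val p v w := by
  -- The inverse chart returns to `p` only up to a propositional equality, so the base point and the
  -- linear map are generalized together before substituting.
  have h : ∀ q, q = p → ∀ (A : TangentSpace (𝓡 (n + 1)) p →L[ℝ] TangentSpace (𝓡 (n + 1)) q),
    (∀ u : TangentSpace (𝓡 (n + 1)) p, (A u : Model n) = u) → g.val q (A v) (A w) = g.val p v w := by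
    rintro q rfl A hA
    rw [show A v = v from hA v, show A w = w from hA w]
  refine h _ (extChartAt_to_inv (I := 𝓡 (n + 1)) p) _ fun u ↦ ?_
  have h := mfderivWithin_range_extChartAt_symm (I := 𝓡 (n + 1)) (x := p)
  rw [ModelWithCorners.range_eq_univ, mfderivWithin_univ] at h
  exact congrArg (fun A : Model n →L[ℝ] Model n => A u) h

theorem contDiffAt_comp_chart_symm {F : Type*} [NormedAddCommGroup F] [NormedSpace ℝ F]
    {f : M → F} {p : M} (hf : ContMDiffAt (𝓡 (n + 1)) 𝓘(ℝ, F) ∞ f p) :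
    ContDiffAt ℝ ∞ (f ∘ (extChartAt (𝓡 (n + 1)) p).symm) (extChartAt (𝓡 (n + 1)) p p) := by
  have h := (contMDiffAt_iff.1 hf).2
  simpa using! h

/-- Smoothness of `g` as a section is smoothness in the trivialization at `p`. The inverse
trivialization of the tangent bundle is the derivative of the inverse chart, so this is the same
coordinate expression. -/
theorem contDiffAt_chartMetric (g : LorentzianMetric n M) (p : M) :
    ContDiffAt ℝ ∞ (chartMetric g p) (extChartAt (𝓡 (n + 1)) p p) := by
  have h := ((contMDiffAt_hom_bundle _).1 (g.contMDiff p)).2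
  refine (contDiffAt_comp_chart_symm h).congr_of_eventuallyEq ?_
  filter_upwards [chart_target_mem_nhds (mem_extChartAt_target (I := 𝓡 (n + 1)) p)] with x hx
  have hq : (extChartAt (𝓡 (n + 1)) p).symm x ∈ (chartAt (Model n) p).source := by
    simpa using (extChartAt (𝓡 (n + 1)) p).map_target hx
  ext u v
  have hy : extChartAt (𝓡 (n + 1)) p ((extChartAt (𝓡 (n + 1)) p).symm x) = x :=
    (extChartAt (𝓡 (n + 1)) p).right_inv hx
  have hs := TangentBundle.symmL_trivializationAt (I := 𝓡 (n + 1)) hq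
  rw [ModelWithCorners.range_eq_univ, mfderivWithin_univ, hy] at hs
  have hs' : ∀ u : Model n, (trivializationAt (Model n) (TangentSpace (𝓡 (n + 1)) (M := M)) p).symm
      ((extChartAt (𝓡 (n + 1)) p).symm x) u =
      mfderiv 𝓘(ℝ, Model n) (𝓡 (n + 1)) (extChartAt (𝓡 (n + 1)) p).symm x u := fun u ↦
    (Trivialization.symmL_apply (R := ℝ) _ hq u).symm.trans (congrArg (fun A : Model n →L[ℝ]
      TangentSpace (𝓡 (n + 1)) ((extChartAt (𝓡 (n + 1)) p).symm x) ↦ A u) hs)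
  rw [Function.comp_apply, inCoordinates_apply_eq₂ hq hq (mem_univ _), hs', hs',
    Trivialization.coe_linearMapAt_of_mem _ (mem_univ _)]
  rfl

theorem contDiffAt_fieldInChart {N : ∀ q : M, TangentSpace (𝓡 (n + 1)) q} {p : M}
    (hN : ContMDiffAt (𝓡 (n + 1)) (𝓡 (n + 1)).tangent ∞
      (fun q : M ↦ (⟨q, N q⟩ : TangentBundle (𝓡 (n + 1)) M)) p) :
    ContDiffAt ℝ ∞ (fieldInChart N p) (extChartAt (𝓡 (n + 1)) p p) := by
  have h := (contMDiffAt_section (IB := 𝓡 (n + 1)) (F := Model n) (E := TangentSpace (𝓡 (n + 1)) (M := M)) p).1 hN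
  refine (contDiffAt_comp_chart_symm h).congr_of_eventuallyEq ?_
  filter_upwards [chart_target_mem_nhds (mem_extChartAt_target (I := 𝓡 (n + 1)) p)] with x hx
  have hq : (extChartAt (𝓡 (n + 1)) p).symm x ∈ (chartAt (Model n) p).source := by
    simpa using (extChartAt (𝓡 (n + 1)) p).map_target hx
  have hs := TangentBundle.continuousLinearMapAt_trivializationAt (I := 𝓡 (n + 1)) hq
  refine (congrArg (fun A : TangentSpace (𝓡 (n + 1)) ((extChartAt (𝓡 (n + 1)) p).symm x) →L[ℝ]
    Model n ↦ A (N _)) hs).symm.trans ?_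
  exact congrFun (Trivialization.coe_linearMapAt_of_mem (R := ℝ)
    (trivializationAt (Model n) (TangentSpace (𝓡 (n + 1)) (M := M)) p) hq) _

theorem fderiv_comp_chart_symm {f : M → ℝ} {p : M} {x : Model n}
    (hx : x ∈ (extChartAt (𝓡 (n + 1)) p).target)
    (hf : MDifferentiableAt (𝓡 (n + 1)) 𝓘(ℝ, ℝ) f ((extChartAt (𝓡 (n + 1)) p).symm x))
    (u : Model n) :
    fderiv ℝ (f ∘ (extChartAt (𝓡 (n + 1)) p).symm) x u =
      mfderiv (𝓡 (n + 1)) 𝓘(ℝ, ℝ) f ((extChartAt (𝓡 (n + 1)) p).symm x)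
        (mfderiv 𝓘(ℝ, Model n) (𝓡 (n + 1)) (extChartAt (𝓡 (n + 1)) p).symm x u) := by
  rw [← mfderiv_eq_fderiv, mfderiv_comp x hf (mdifferentiableAt_chart_symm hx)]
  rfl

theorem fderiv_comp_chart_symm_self {f : M → ℝ} {p : M}
    (hf : MDifferentiableAt (𝓡 (n + 1)) 𝓘(ℝ, ℝ) f p) (u : Model n) :
    fderiv ℝ (f ∘ (extChartAt (𝓡 (n + 1)) p).symm) (extChartAt (𝓡 (n + 1)) p p) u =
      mfderiv (𝓡 (n + 1)) 𝓘(ℝ, ℝ) f p u := by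
  have h := congrArg (fun A : Model n →L[ℝ] ℝ ↦ A u) hf.mfderiv
  refine Eq.trans ?_ h.symm
  simp only [writtenInExtChartAt, Function.comp_def, ModelWithCorners.range_eq_univ,
    fderivWithin_univ, extChartAt_model_space_eq_id, PartialEquiv.refl_coe, id]

/-- A submersion is given by a local normal form: in suitable charts `τ` is a linear isomorphism
followed by the projection to `ℝ`. A zero differential would kill that projection, which takes the
value `1` on the preimage of `(1, 0)`. -/
theorem mfderiv_ne_zero_of_isSubmersion {τ : M → ℝ}
    (hτ : IsSubmersion (𝓡 (n + 1)) 𝓘(ℝ, ℝ) ∞ τ) (p : M) :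
    mfderiv (𝓡 (n + 1)) 𝓘(ℝ, ℝ) τ p ≠ 0 := by
  intro h0
  have hd := (hτ.contMDiff p).mdifferentiableAt (by simp)
  obtain ⟨F, _, _, hF⟩ := hτ
  have h := hF p
  set φ := h.domChart
  set ψ := h.codChart
  have hx : φ p ∈ φ.target := φ.map_source h.mem_domChart_source
  have hψ : MDifferentiableAt 𝓘(ℝ, ℝ) 𝓘(ℝ, ℝ) ψ (τ p) :=
    ((contMDiffOn_of_mem_maximalAtlas h.codChart_mem_maximalAtlas).contMDiffAt
      (ψ.open_source.mem_nhds h.mem_codChart_source)).mdifferentiableAt (by simp)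
  have hφ : MDifferentiableAt 𝓘(ℝ, Model n) (𝓡 (n + 1)) φ.symm (φ p) :=
    ((contMDiffOn_symm_of_mem_maximalAtlas h.domChart_mem_maximalAtlas).contMDiffAt
      (φ.open_target.mem_nhds hx)).mdifferentiableAt (by simp)
  have hp : φ.symm (φ p) = p := φ.left_inv h.mem_domChart_source
  have hd' : HasMFDerivAt (𝓡 (n + 1)) 𝓘(ℝ, ℝ) τ (φ.symm (φ p)) 0 := by
    rw [hp, ← h0]; exact hd.hasMFDerivAt
  have hψ' : MDifferentiableAt 𝓘(ℝ, ℝ) 𝓘(ℝ, ℝ) ψ (τ (φ.symm (φ p))) := by rwa [hp]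
  have hc := hψ'.hasMFDerivAt.comp (φ p) (hd'.comp (φ p) hφ.hasMFDerivAt)
  have hc' : HasFDerivAt (ψ ∘ τ ∘ φ.symm) (0 : Model n →L[ℝ] ℝ) (φ p) := by
    have := hc.hasFDerivAt
    have h0 : (0 : Model n →L[ℝ] ℝ) = (mfderiv 𝓘(ℝ, ℝ) 𝓘(ℝ, ℝ) ψ (τ (φ.symm (φ p)))).comp
        ((0 : TangentSpace (𝓡 (n + 1)) (φ.symm (φ p)) →L[ℝ] ℝ).comp
          (mfderiv 𝓘(ℝ, Model n) (𝓡 (n + 1)) φ.symm (φ p))) :=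
      ContinuousLinearMap.ext fun _ ↦
        (map_zero (mfderiv 𝓘(ℝ, ℝ) 𝓘(ℝ, ℝ) ψ (τ (φ.symm (φ p))))).symm
    rw [h0]
    exact this
  have he : HasFDerivAt (ψ ∘ τ ∘ φ.symm)
      ((ContinuousLinearMap.fst ℝ ℝ F).comp (h.equiv : Model n →L[ℝ] ℝ × F)) (φ p) := by
    refine ((ContinuousLinearMap.fst ℝ ℝ F).comp
      (h.equiv : Model n →L[ℝ] ℝ × F)).hasFDerivAt.congr_of_eventuallyEq ?_
    filter_upwards [φ.open_target.mem_nhds hx] with y hy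
    have hy' : y ∈ (φ.extend (𝓡 (n + 1))).target := by simpa using hy
    simpa using! h.writtenInCharts hy'
  have := congrArg (fun A : Model n →L[ℝ] ℝ ↦ A (h.equiv.symm (1, 0))) (hc'.unique he)
  simp at this

end ChartCalculus

section DefiningFunctions

/-! ### Constrained extrema in a normed space -/

section Constrained

variable {E : Type*} [NormedAddCommGroup E] [NormedSpace ℝ E]

theorem exists_multiplier [CompleteSpace E] {f φ : E → ℝ} {f' φ' : StrongDual ℝ E} {x₀ : E}
    (hextr : IsLocalExtrOn φ {x | f x = f x₀} x₀) (hf : HasStrictFDerivAt f f' x₀)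
    (hφ : HasStrictFDerivAt φ φ' x₀) (hf' : f' ≠ 0) : ∃ κ : ℝ, φ' = κ • f' := by
  obtain ⟨a, b, hab, h⟩ := hextr.exists_multipliers_of_hasStrictFDerivAt_1d hf hφ
  have hb : b ≠ 0 := by
    rintro rfl
    have ha : a ≠ 0 := fun ha ↦ hab (by rw [ha]; rfl)
    exact hf' (by simpa [ha] using h)
  refine ⟨-(b⁻¹ * a), ?_⟩
  have : φ' = b⁻¹ • (b • φ') := by rw [smul_smul, inv_mul_cancel₀ hb, one_smul]
  rw [this, eq_neg_of_add_eq_zero_right h, smul_neg, smul_smul]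
  exact (neg_smul _ _).symm

/-- Subtracting half the quadratic form leaves a function whose derivative at `z` is `fderiv ℝ L z -
B (z - x₀)`, which is `o(‖z - x₀‖)`; the mean value inequality on a closed ball integrates this
bound. -/
theorem eventually_taylor_two {L : E → ℝ} {x₀ : E} (hL : ContDiffAt ℝ 2 L x₀)
    (h0 : fderiv ℝ L x₀ = 0) {ε : ℝ} (hε : 0 < ε) :
    ∀ᶠ y in 𝓝 x₀, |L y - L x₀ - fderiv ℝ (fderiv ℝ L) x₀ (y - x₀) (y - x₀) / 2| ≤
      ε * ‖y - x₀‖ ^ 2 := by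
  set B := fderiv ℝ (fderiv ℝ L) x₀
  have hsymm : ∀ u v, B u v = B v u := fun u v ↦ (hL.isSymmSndFDerivAt (by simp)) u v
  have hB : HasFDerivAt (fderiv ℝ L) B x₀ :=
    ((hL.fderiv_right (m := 1) (by norm_num)).differentiableAt (by simp)).hasFDerivAt
  have h1 : ∀ᶠ y in 𝓝 x₀, ‖fderiv ℝ L y - B (y - x₀)‖ ≤ ε * ‖y - x₀‖ := by
    filter_upwards [hB.isLittleO.bound hε] with y hy
    simpa [h0] using hy
  have h2 : ∀ᶠ y in 𝓝 x₀, DifferentiableAt ℝ L y := by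
    filter_upwards [hL.eventually (by simp)] with y hy using hy.differentiableAt (by simp)
  obtain ⟨r, hr, hball⟩ := Metric.eventually_nhds_iff_ball.1 (h1.and h2)
  filter_upwards [Metric.ball_mem_nhds x₀ hr] with y hy
  have hsub : Metric.closedBall x₀ ‖y - x₀‖ ⊆ Metric.ball x₀ r := by
    apply Metric.closedBall_subset_ball
    rwa [Metric.mem_ball, dist_eq_norm] at hy
  have hd : ∀ z ∈ Metric.closedBall x₀ ‖y - x₀‖,
      HasFDerivWithinAt (fun z ↦ L z - B (z - x₀) (z - x₀) * (1 / 2))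
        (fderiv ℝ L z - B (z - x₀)) (Metric.closedBall x₀ ‖y - x₀‖) z := by
    intro z hz
    have e1 : HasFDerivAt (fun z : E ↦ z - x₀) (ContinuousLinearMap.id ℝ E) z :=
      (hasFDerivAt_id z).sub_const x₀
    have e2 := ((B.hasFDerivAt.comp z e1).clm_apply e1).mul_const (1 / 2 : ℝ)
    have e3 : HasFDerivAt (fun z ↦ L z - B (z - x₀) (z - x₀) * (1 / 2)) _ z :=
      (hball z (hsub hz)).2.hasFDerivAt.sub e2
    refine (e3.congr_fderiv ?_).hasFDerivWithinAt
    ext u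
    have := hsymm u (z - x₀)
    simp only [map_sub, sub_apply] at this
    simp
    linarith
  have hb : ∀ z ∈ Metric.closedBall x₀ ‖y - x₀‖, ‖fderiv ℝ L z - B (z - x₀)‖ ≤ ε * ‖y - x₀‖ := by
    intro z hz
    refine (hball z (hsub hz)).1.trans ?_
    rw [Metric.mem_closedBall, dist_eq_norm] at hz
    gcongr
  have := (convex_closedBall x₀ ‖y - x₀‖).norm_image_sub_le_of_norm_hasFDerivWithin_le hd hb
    (Metric.mem_closedBall_self (norm_nonneg _)) (y := y) (by simp [dist_eq_norm])
  rw [Real.norm_eq_abs] at this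
  calc _ = _ := by congr 1; simp; ring
    _ ≤ _ := this
    _ = _ := by ring

theorem eventually_lt_of_hasDerivAt_pos {h : ℝ → ℝ} {c : ℝ} (hh : HasDerivAt h c 0) (hc : 0 < c) :
    ∀ᶠ t in 𝓝[>] (0 : ℝ), h 0 < h t := by
  have h1 := (hasDerivAt_iff_tendsto_slope.1 hh).mono_left
    (nhdsWithin_mono 0 fun t (ht : (0 : ℝ) < t) ↦ ht.ne')
  filter_upwards [h1.eventually (lt_mem_nhds hc), self_mem_nhdsWithin] with t h2 (h3 : 0 < t)
  rw [slope_def_field, sub_zero] at h2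
  have := (div_pos_iff_of_pos_right h3).1 h2
  linarith

theorem eventually_forall_line {x₀ : E} {P : E → Prop} (h : ∀ᶠ y in 𝓝 x₀, P y) (X w : E) (δ : ℝ) :
    ∀ᶠ t in 𝓝[>] (0 : ℝ), ∀ s ∈ Icc (-δ) δ, P (x₀ + t • (X + s • w)) := by
  refine nhdsWithin_le_nhds ?_
  refine isCompact_Icc.eventually_forall_of_forall_eventually fun s _ ↦ ?_
  have hc : ContinuousAt (fun z : ℝ × ℝ ↦ x₀ + z.1 • (X + z.2 • w)) (0, s) := by fun_prop
  refine hc.eventually ?_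
  simpa using h

/-- A substitute for the implicit function theorem. The derivative of `f` in the direction `X + s •
w` is `s`, so for small `t > 0` the value of `f` is above `f x₀` at `s = δ` and below it at `s =
-δ`; the intermediate value theorem in `s` gives the point. -/
theorem eventually_exists_level_point {f : E → ℝ} {x₀ : E} (hf : ContDiffAt ℝ 1 f x₀) {X w : E}
    (hX : fderiv ℝ f x₀ X = 0) (hw : fderiv ℝ f x₀ w = 1) {δ : ℝ} (hδ : 0 < δ) :
    ∀ᶠ t in 𝓝[>] (0 : ℝ), ∃ s ∈ Icc (-δ) δ, f (x₀ + t • (X + s • w)) = f x₀ := by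
  have hline : ∀ s : ℝ, HasDerivAt (fun t : ℝ ↦ f (x₀ + t • (X + s • w))) s 0 := by
    intro s
    have h1 : HasDerivAt (fun t : ℝ ↦ x₀ + t • (X + s • w)) (X + s • w) 0 := by
      simpa using ((hasDerivAt_id (0 : ℝ)).smul_const (X + s • w)).const_add x₀
    have h2 : HasFDerivAt f (fderiv ℝ f x₀) (x₀ + (0 : ℝ) • (X + s • w)) := by
      simpa using (hf.differentiableAt (by simp)).hasFDerivAt
    simpa [hX, hw] using! h2.comp_hasDerivAt (0 : ℝ) h1
  have hpos : ∀ᶠ t in 𝓝[>] (0 : ℝ), f x₀ < f (x₀ + t • (X + δ • w)) := by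
    simpa using eventually_lt_of_hasDerivAt_pos (hline δ) hδ
  have hneg : ∀ᶠ t in 𝓝[>] (0 : ℝ), f (x₀ + t • (X + (-δ) • w)) < f x₀ := by
    simpa using eventually_lt_of_hasDerivAt_pos (hline (-δ)).neg (by simpa using hδ)
  have hcont : ∀ᶠ y in 𝓝 x₀, ContinuousAt f y := by
    filter_upwards [hf.eventually (by simp)] with y hy using hy.continuousAt
  have hcont' : ∀ᶠ t in 𝓝[>] (0 : ℝ), ∀ s ∈ Icc (-δ) δ, ContinuousAt f (x₀ + t • (X + s • w)) :=
    eventually_forall_line hcont X w δ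
  filter_upwards [hpos, hneg, hcont'] with t h1 h2 h3
  have hc : ContinuousOn (fun s : ℝ ↦ f (x₀ + t • (X + s • w))) (Icc (-δ) δ) := by
    intro s hs
    exact ((h3 s hs).comp (f := fun s : ℝ ↦ x₀ + t • (X + s • w))
      (by fun_prop)).continuousWithinAt
  obtain ⟨s, hs, h⟩ := intermediate_value_Icc (by linarith) hc ⟨h2.le, h1.le⟩
  exact ⟨s, hs, h⟩

/-- The Lagrangian `L = φ - κ f` is critical at `x₀` and differs from `φ` by a constant on the level
set. Were its second derivative positive at `X`, Taylor's formula at level points `x₀ + t • (X + s •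
w)` with small `s` would give `L` a value above `L x₀`, against maximality. -/
theorem snd_fderiv_le_of_isLocalMaxOn {f φ : E → ℝ} {x₀ : E} (hf : ContDiffAt ℝ 2 f x₀)
    (hφ : ContDiffAt ℝ 2 φ x₀) (hmax : IsLocalMaxOn φ {x | f x = f x₀} x₀) {κ : ℝ}
    (hκ : fderiv ℝ φ x₀ = κ • fderiv ℝ f x₀) (hf' : fderiv ℝ f x₀ ≠ 0) {X : E}
    (hX : fderiv ℝ f x₀ X = 0) :
    fderiv ℝ (fderiv ℝ φ) x₀ X X ≤ κ * fderiv ℝ (fderiv ℝ f) x₀ X X := by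
  set L : E → ℝ := fun x ↦ φ x - κ * f x with hLdef
  have hL : ContDiffAt ℝ 2 L x₀ := hφ.sub (contDiffAt_const.mul hf)
  have hL' : fderiv ℝ L =ᶠ[𝓝 x₀] fun x ↦ fderiv ℝ φ x - κ • fderiv ℝ f x := by
    filter_upwards [hφ.eventually (by simp), hf.eventually (by simp)] with x h1 h2
    have d1 := (h1.differentiableAt (by simp)).hasFDerivAt
    have d2 := (h2.differentiableAt (by simp)).hasFDerivAt
    exact (d1.sub (d2.const_mul κ)).fderiv
  have h0 : fderiv ℝ L x₀ = 0 := by rw [hL'.eq_of_nhds, hκ, sub_self]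
  have hsnd : fderiv ℝ (fderiv ℝ L) x₀ X X =
      fderiv ℝ (fderiv ℝ φ) x₀ X X - κ * fderiv ℝ (fderiv ℝ f) x₀ X X := by
    have d1 := ((hφ.fderiv_right (m := 1) (by norm_num)).differentiableAt (by simp)).hasFDerivAt
    have d2 := ((hf.fderiv_right (m := 1) (by norm_num)).differentiableAt (by simp)).hasFDerivAt
    have d3 : HasFDerivAt (fun x ↦ fderiv ℝ φ x - κ • fderiv ℝ f x) _ x₀ :=
      d1.sub (d2.const_smul κ)
    rw [hL'.fderiv_eq, d3.fderiv]
    simp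
  suffices h : ¬ 0 < fderiv ℝ (fderiv ℝ L) x₀ X X by linarith [not_lt.1 h]
  intro hpos
  set B := fderiv ℝ (fderiv ℝ L) x₀ with hBdef
  obtain ⟨w, hw⟩ : ∃ w, fderiv ℝ f x₀ w = 1 := by
    obtain ⟨v, hv⟩ := DFunLike.ne_iff.1 hf'
    exact ⟨(fderiv ℝ f x₀ v)⁻¹ • v, by simpa using inv_mul_cancel₀ hv⟩
  obtain ⟨ε, hε, hεX⟩ : ∃ ε > 0, ε * ‖X‖ ^ 2 < B X X / 2 := by
    refine ⟨B X X / (4 * (‖X‖ ^ 2 + 1)), by positivity, ?_⟩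
    rw [div_mul_eq_mul_div, div_lt_div_iff₀ (by positivity) (by norm_num)]
    nlinarith [sq_nonneg ‖X‖]
  -- The quadratic term must beat the Taylor error in every direction near `X`, because the
  -- correction `s` is known only to be small.
  obtain ⟨δ, hδ, hδX⟩ : ∃ δ > (0 : ℝ), ∀ s ∈ Icc (-δ) δ,
      ε * ‖X + s • w‖ ^ 2 < B (X + s • w) (X + s • w) / 2 := by
    have h1 : ContinuousAt (fun s : ℝ ↦ ε * ‖X + s • w‖ ^ 2) 0 := by fun_prop
    have h2 : ContinuousAt (fun s : ℝ ↦ B (X + s • w) (X + s • w) / 2) 0 := by fun_prop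
    have h3 := h1.eventually_lt h2 (by simpa using hεX)
    obtain ⟨δ, hδ, h⟩ := Metric.eventually_nhds_iff.1 h3
    refine ⟨δ / 2, by positivity, fun s hs ↦ h ?_⟩
    rw [Real.dist_eq, sub_zero, abs_lt]
    constructor <;> linarith [hs.1, hs.2]
  have hmax' : ∀ᶠ y in 𝓝 x₀, f y = f x₀ → φ y ≤ φ x₀ := eventually_nhdsWithin_iff.1 hmax
  obtain ⟨t, ⟨⟨s, hs, hft⟩, hbound⟩, ht : 0 < t⟩ :=
    (((eventually_exists_level_point (hf.of_le (by norm_num)) hX hw hδ).and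
      (eventually_forall_line ((eventually_taylor_two hL h0 hε).and hmax') X w δ)).and
      self_mem_nhdsWithin).exists
  obtain ⟨h1, h2⟩ := hbound s hs
  have h3 := hδX s hs
  have h4 : L (x₀ + t • (X + s • w)) ≤ L x₀ := by
    simp only [hLdef, hft]
    linarith [h2 hft]
  rw [← hBdef, add_sub_cancel_left, norm_smul, mul_pow, Real.norm_eq_abs, sq_abs] at h1
  simp only [map_smul, smul_apply, smul_eq_mul] at h1
  have h5 := (abs_le.1 h1).1
  have h6 : 0 < t ^ 2 := by positivity
  nlinarith [mul_lt_mul_of_pos_left h3 h6]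

theorem le_snd_fderiv_of_isLocalMinOn {f φ : E → ℝ} {x₀ : E} (hf : ContDiffAt ℝ 2 f x₀)
    (hφ : ContDiffAt ℝ 2 φ x₀) (hmin : IsLocalMinOn φ {x | f x = f x₀} x₀) {κ : ℝ}
    (hκ : fderiv ℝ φ x₀ = κ • fderiv ℝ f x₀) (hf' : fderiv ℝ f x₀ ≠ 0) {X : E}
    (hX : fderiv ℝ f x₀ X = 0) :
    κ * fderiv ℝ (fderiv ℝ f) x₀ X X ≤ fderiv ℝ (fderiv ℝ φ) x₀ X X := by
  have hneg : fderiv ℝ (fun x ↦ -φ x) = fun x ↦ -fderiv ℝ φ x := funext fun x ↦ fderiv_fun_neg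
  have hκ' : fderiv ℝ (fun x ↦ -φ x) x₀ = (-κ) • fderiv ℝ f x₀ := by
    rw [hneg, neg_smul, ← hκ]
  have h := snd_fderiv_le_of_isLocalMaxOn hf hφ.neg hmin.neg hκ' hf' hX
  have h2 : fderiv ℝ (fderiv ℝ fun x ↦ -φ x) x₀ = -fderiv ℝ (fderiv ℝ φ) x₀ := by
    rw [hneg, fderiv_fun_neg]
  rw [h2] at h
  simp only [neg_apply] at h
  linarith

end Constrained

/-! ### Independence of the trace from the orthonormal frame -/

section Trace

variable {E : Type*} [AddCommGroup E] [Module ℝ E] [FiniteDimensional ℝ E]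

/-- Both frames are bases of the kernel of `ℓ`, by dimension. Their transition matrix satisfies `A *
Aᵀ = 1`, hence also `Aᵀ * A = 1`, and the latter collapses the double sum. It lets two mean
curvatures computed in different frames be compared. -/
theorem sum_apply_eq_of_orthonormal {n : ℕ} (hn : Module.finrank ℝ E = n + 1) {ℓ : E →ₗ[ℝ] ℝ}
    (hℓ : ℓ ≠ 0) (G B : E →ₗ[ℝ] E →ₗ[ℝ] ℝ) {e e' : Fin n → E} (he : ∀ i, ℓ (e i) = 0)
    (he' : ∀ i, ℓ (e' i) = 0) (hG : ∀ i j, G (e i) (e j) = if i = j then 1 else 0)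
    (hG' : ∀ i j, G (e' i) (e' j) = if i = j then 1 else 0) :
    ∑ i, B (e i) (e i) = ∑ i, B (e' i) (e' i) := by
  have hli : LinearIndependent ℝ e := by
    rw [Fintype.linearIndependent_iff]
    intro c hc j
    simpa [hG] using congrArg (fun v ↦ G v (e j)) hc
  have hspan : Submodule.span ℝ (range e) = LinearMap.ker ℓ := by
    refine Submodule.eq_of_le_of_finrank_eq ?_ ?_
    · rw [Submodule.span_le]
      rintro _ ⟨i, rfl⟩
      exact he i
    · have := Module.Dual.finrank_ker_add_one_of_ne_zero hℓ
      rw [finrank_span_eq_card hli, Fintype.card_fin]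
      omega
  have hexp : ∀ j, ∃ c : Fin n → ℝ, ∑ i, c i • e i = e' j := fun j ↦ by
    have : e' j ∈ Submodule.span ℝ (range e) := hspan ▸ he' j
    exact (Submodule.mem_span_range_iff_exists_fun ℝ).1 this
  choose c hc using hexp
  set A : Matrix (Fin n) (Fin n) ℝ := Matrix.of c
  have h1 : A * A.transpose = 1 := by
    ext j k
    have := hG' j k
    rw [← hc j, ← hc k] at this
    simpa [A, Matrix.mul_apply, hG, Matrix.one_apply, mul_comm] using this
  have h2 : A.transpose * A = 1 := mul_eq_one_comm.1 h1
  have h3 : ∀ i l, ∑ j, c j i * c j l = if i = l then 1 else 0 := fun i l ↦ by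
    simpa [A, Matrix.mul_apply, Matrix.one_apply] using congrFun (congrFun h2 i) l
  calc ∑ i, B (e i) (e i) = ∑ i, ∑ l, (∑ j, c j i * c j l) * B (e i) (e l) := by
        simp [h3]
    _ = ∑ i, ∑ l, ∑ j, c j i * c j l * B (e i) (e l) := by simp_rw [Finset.sum_mul]
    _ = ∑ i, ∑ j, ∑ l, c j i * c j l * B (e i) (e l) :=
        Finset.sum_congr rfl fun i _ ↦ Finset.sum_comm
    _ = ∑ j, ∑ i, ∑ l, c j i * c j l * B (e i) (e l) := Finset.sum_comm
    _ = ∑ j, B (e' j) (e' j) := by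
        refine Finset.sum_congr rfl fun j _ ↦ ?_
        rw [← hc j]
        simp only [map_sum, map_smul, LinearMap.sum_apply, LinearMap.smul_apply, smul_eq_mul,
          Finset.mul_sum]
        rw [Finset.sum_comm]
        exact Finset.sum_congr rfl fun i _ ↦ Finset.sum_congr rfl fun l _ ↦ by ring

end Trace

/-! ### Tangent vectors of a hypersurface -/

variable {n : ℕ} {M : Type*} [TopologicalSpace M]
  [ChartedSpace (Model n) M] [IsManifold (𝓡 (n + 1)) ∞ M]

theorem tendsto_chart_symm {p : M} {x : Model n} (hx : x ∈ (extChartAt (𝓡 (n + 1)) p).target) :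
    Tendsto (extChartAt (𝓡 (n + 1)) p).symm (𝓝 x) (𝓝 ((extChartAt (𝓡 (n + 1)) p).symm x)) :=
  continuousAt_extChartAt_symm'' hx

theorem tendsto_chart_symm_self (p : M) :
    Tendsto (extChartAt (𝓡 (n + 1)) p).symm (𝓝 (extChartAt (𝓡 (n + 1)) p p)) (𝓝 p) := by
  have h := tendsto_chart_symm (n := n) (mem_extChartAt_target (I := 𝓡 (n + 1)) p)
  rwa [extChartAt_to_inv] at h

theorem fderiv_comp_chart_symm_ne_zero {f : M → ℝ} {p : M}
    (hf : MDifferentiableAt (𝓡 (n + 1)) 𝓘(ℝ, ℝ) f p)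
    (hf' : mfderiv (𝓡 (n + 1)) 𝓘(ℝ, ℝ) f p ≠ 0) :
    fderiv ℝ (f ∘ (extChartAt (𝓡 (n + 1)) p).symm) (extChartAt (𝓡 (n + 1)) p p) ≠ 0 := fun h ↦
  hf' <| ContinuousLinearMap.ext fun u ↦
    (fderiv_comp_chart_symm_self hf u).symm.trans (congrArg (fun A : Model n →L[ℝ] ℝ ↦ A u) h)

/-- A function vanishing on `S` is constant on the zero set of `f` near `p`, hence extremal there,
so by the multiplier rule its differential is a multiple of that of `f`. -/
theorem isTangentTo_of_mfderiv_eq_zero {S : Set M} {f : M → ℝ} {p : M} (hp : f p = 0)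
    (hf : ContMDiffAt (𝓡 (n + 1)) 𝓘(ℝ, ℝ) ∞ f p)
    (hf' : mfderiv (𝓡 (n + 1)) 𝓘(ℝ, ℝ) f p ≠ 0) (hS : ∀ᶠ q in 𝓝 p, f q = 0 → q ∈ S)
    {v : TangentSpace (𝓡 (n + 1)) p} (hv : mfderiv (𝓡 (n + 1)) 𝓘(ℝ, ℝ) f p v = (0 : ℝ)) :
    IsTangentTo S v := by
  intro h hh hhS
  have hfd := hf.mdifferentiableAt (by simp)
  have hhd := hh.mdifferentiableAt (by simp)
  have hhS' : ∀ᶠ q in 𝓝 p, f q = 0 → h q = 0 := by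
    filter_upwards [hS, eventually_nhdsWithin_iff.1 hhS] with q h1 h2 h3 using h2 (h1 h3)
  have hinv : (extChartAt (𝓡 (n + 1)) p).symm (extChartAt (𝓡 (n + 1)) p p) = p :=
    extChartAt_to_inv p
  obtain ⟨κ, hκ⟩ := exists_multiplier (x₀ := extChartAt (𝓡 (n + 1)) p p)
    (f := f ∘ (extChartAt (𝓡 (n + 1)) p).symm) (φ := h ∘ (extChartAt (𝓡 (n + 1)) p).symm)
    (by
      refine Or.inl (eventually_nhdsWithin_iff.2 ?_)
      filter_upwards [(tendsto_chart_symm_self p).eventually hhS'] with x hx hxS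
      have h0 : h p = 0 := hhS'.self_of_nhds hp
      have : (f ∘ (extChartAt (𝓡 (n + 1)) p).symm) x = 0 := by
        exact (show _ = _ from hxS).trans (by rw [Function.comp_apply, hinv, hp])
      simp only [Function.comp_apply, hinv] at this ⊢
      rw [hx this, h0])
    ((contDiffAt_comp_chart_symm hf).hasStrictFDerivAt (by simp))
    ((contDiffAt_comp_chart_symm hh).hasStrictFDerivAt (by simp))
    (fderiv_comp_chart_symm_ne_zero hfd hf')
  refine (fderiv_comp_chart_symm_self hhd v).symm.trans ?_
  have := (fderiv_comp_chart_symm_self hfd v).trans hv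
  rw [hκ]
  exact (congrArg (κ * ·) this).trans (mul_zero κ)

/-- A local defining function of a hypersurface. -/
structure IsDefiningFunctionAt (S : Set M) (p : M) (f : M → ℝ) : Prop where
  contMDiffAt : ∀ᶠ q in 𝓝 p, ContMDiffAt (𝓡 (n + 1)) 𝓘(ℝ, ℝ) ∞ f q
  mem_iff : ∀ᶠ q in 𝓝 p, q ∈ S ↔ f q = 0
  mfderiv_ne_zero : ∀ᶠ q in 𝓝 p, mfderiv (𝓡 (n + 1)) 𝓘(ℝ, ℝ) f q ≠ 0

theorem IsHypersurface.exists_isDefiningFunctionAt {S : Set M} (hS : IsHypersurface n S) {p : M}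
    (hp : p ∈ S) : ∃ f : M → ℝ, IsDefiningFunctionAt (n := n) S p f := by
  obtain ⟨U, f, hU, hpU, hf, hmem, hne⟩ := hS p hp
  have hUp := hU.mem_nhds hpU
  refine ⟨f, ?_, ?_, ?_⟩
  · filter_upwards [hUp] with q hq using hf.contMDiffAt (hU.mem_nhds hq)
  · filter_upwards [hUp] with q hq using hmem q hq
  · filter_upwards [hUp] with q hq using hne q hq

theorem IsDefiningFunctionAt.eventually {S : Set M} {p : M} {f : M → ℝ}
    (hf : IsDefiningFunctionAt (n := n) S p f) :
    ∀ᶠ q in 𝓝 p, IsDefiningFunctionAt (n := n) S q f := by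
  filter_upwards [hf.contMDiffAt.eventually_nhds, hf.mem_iff.eventually_nhds,
    hf.mfderiv_ne_zero.eventually_nhds] with q h1 h2 h3 using ⟨h1, h2, h3⟩

theorem IsDefiningFunctionAt.isTangentTo_iff {S : Set M} {p : M} {f : M → ℝ}
    (hf : IsDefiningFunctionAt (n := n) S p f) (hp : p ∈ S) (v : TangentSpace (𝓡 (n + 1)) p) :
    IsTangentTo S v ↔ mfderiv (𝓡 (n + 1)) 𝓘(ℝ, ℝ) f p v = (0 : ℝ) := by
  refine ⟨fun h ↦ h f hf.contMDiffAt.self_of_nhds ?_, fun h ↦ ?_⟩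
  · refine eventually_nhdsWithin_iff.2 ?_
    filter_upwards [hf.mem_iff] with q hq using hq.1
  · refine isTangentTo_of_mfderiv_eq_zero (hf.mem_iff.self_of_nhds.1 hp)
      hf.contMDiffAt.self_of_nhds hf.mfderiv_ne_zero.self_of_nhds ?_ h
    filter_upwards [hf.mem_iff] with q hq using hq.2

end DefiningFunctions

section SecondFundamentalForm

/-! ### Comparison of second fundamental forms -/

/-- The field paired with `N` is the constant field `X` corrected along `w` so as to be tangent to
the level sets of `f`. It equals `X` at `x₀`, and the derivative of the correction produces the
second derivative of `f`. -/
theorem fderiv_apply_tangent_field {E : Type*} [NormedAddCommGroup E] [NormedSpace ℝ E]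
    {G : E → E →L[ℝ] E →L[ℝ] ℝ} {N : E → E} {f : E → ℝ} {x₀ X w : E}
    (hG : DifferentiableAt ℝ G x₀) (hN : DifferentiableAt ℝ N x₀) (hf : ContDiffAt ℝ 2 f x₀)
    (hX : fderiv ℝ f x₀ X = 0) (hw : fderiv ℝ f x₀ w ≠ 0) :
    fderiv ℝ (fun x ↦ G x (N x) (X - (fderiv ℝ f x X / fderiv ℝ f x w) • w)) x₀ X =
      fderiv ℝ G x₀ X (N x₀) X + G x₀ (fderiv ℝ N x₀ X) X
        - fderiv ℝ (fderiv ℝ f) x₀ X X / fderiv ℝ f x₀ w * G x₀ (N x₀) w := by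
  have hf2 : HasFDerivAt (fderiv ℝ f) (fderiv ℝ (fderiv ℝ f) x₀) x₀ :=
    ((hf.fderiv_right (m := 1) (by norm_num)).differentiableAt (by simp)).hasFDerivAt
  have h1 := hf2.clm_apply (hasFDerivAt_const X x₀)
  have h2 := hf2.clm_apply (hasFDerivAt_const w x₀)
  have h3 := ((h1.mul ((hasDerivAt_inv hw).comp_hasFDerivAt x₀ h2)).smul_const w).const_sub X
  have h4 := (hG.hasFDerivAt.clm_apply hN.hasFDerivAt).clm_apply h3
  have h5 : HasFDerivAt (fun x ↦ G x (N x) (X - (fderiv ℝ f x X / fderiv ℝ f x w) • w)) _ x₀ := h4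
  rw [h5.fderiv]
  simp [hX]
  field_simp
  ring

/-- The bilinear form `G(A X, Y) + (D_X(ν, Y) + D_ν(X, Y) - D_Y(X, ν)) / 2`. -/
def christoffelForm {E : Type*} [NormedAddCommGroup E] [NormedSpace ℝ E] (G : E →L[ℝ] E →L[ℝ] ℝ)
    (A : E →L[ℝ] E) (D : E →L[ℝ] E →L[ℝ] E →L[ℝ] ℝ) (ν : E) : E →ₗ[ℝ] E →ₗ[ℝ] ℝ :=
  LinearMap.mk₂ ℝ (fun X Y ↦ G (A X) Y + (D X ν Y + D ν X Y - D Y X ν) / 2)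
    (fun X X' Y ↦ by
      rw [A.map_add, G.map_add, D.map_add, (D ν).map_add, (D Y).map_add]
      simp only [add_apply]
      ring)
    (fun c X Y ↦ by
      rw [A.map_smul, G.map_smul, D.map_smul, (D ν).map_smul, (D Y).map_smul]
      simp only [smul_apply, smul_eq_mul]
      ring)
    (fun X Y Y' ↦ by
      rw [(G (A X)).map_add, D.map_add, (D X ν).map_add, (D ν X).map_add]
      simp only [add_apply]
      ring)
    (fun c X Y ↦ by
      rw [(G (A X)).map_smul, D.map_smul, (D X ν).map_smul, (D ν X).map_smul]
      simp only [smul_apply, smul_eq_mul]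
      ring)

variable {n : ℕ} {M : Type*} [TopologicalSpace M]
  [ChartedSpace (Model n) M] [IsManifold (𝓡 (n + 1)) ∞ M]

theorem differentiableAt_chartMetric (g : LorentzianMetric n M) (p : M) :
    DifferentiableAt ℝ (chartMetric g p) (extChartAt (𝓡 (n + 1)) p p) :=
  (contDiffAt_chartMetric g p).differentiableAt (by simp)

theorem fderiv_metricInChart (g : LorentzianMetric n M) (p : M) (u v w : Model n) :
    fderiv ℝ (fun x ↦ metricInChart g p x v w) (extChartAt (𝓡 (n + 1)) p p) u =
      fderiv ℝ (chartMetric g p) (extChartAt (𝓡 (n + 1)) p p) u v w := by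
  have h := ((differentiableAt_chartMetric g p).hasFDerivAt.clm_apply
    (hasFDerivAt_const v _)).clm_apply (hasFDerivAt_const w _)
  have h' : HasFDerivAt (fun x ↦ metricInChart g p x v w) _ (extChartAt (𝓡 (n + 1)) p p) := h
  rw [h'.fderiv]
  simp

theorem fieldInChart_self (N : ∀ q : M, TangentSpace (𝓡 (n + 1)) q) (p : M) :
    fieldInChart N p (extChartAt (𝓡 (n + 1)) p p) = N p := by
  unfold fieldInChart
  rw [extChartAt_to_inv]
  exact vectorInChart_self _

theorem covDeriv_eq (g : LorentzianMetric n M) (N : ∀ q : M, TangentSpace (𝓡 (n + 1)) q) (p : M)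
    (X Y : Model n) :
    covDeriv g N p X Y =
      chartMetric g p (extChartAt (𝓡 (n + 1)) p p)
        (fderiv ℝ (fieldInChart N p) (extChartAt (𝓡 (n + 1)) p p) X) Y
      + (fderiv ℝ (chartMetric g p) (extChartAt (𝓡 (n + 1)) p p) X
            (fieldInChart N p (extChartAt (𝓡 (n + 1)) p p)) Y
        + fderiv ℝ (chartMetric g p) (extChartAt (𝓡 (n + 1)) p p)
            (fieldInChart N p (extChartAt (𝓡 (n + 1)) p p)) X Y
        - fderiv ℝ (chartMetric g p) (extChartAt (𝓡 (n + 1)) p p) Y X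
            (fieldInChart N p (extChartAt (𝓡 (n + 1)) p p))) / 2 := by
  have hv : ∀ v : Model n, vectorInChart p (q := p) v = v := fun v ↦ vectorInChart_self v
  have hN : vectorInChart p (N p) = fieldInChart N p (extChartAt (𝓡 (n + 1)) p p) :=
    (hv (N p)).trans (fieldInChart_self N p).symm
  unfold covDeriv christoffel
  rw [fderiv_metricInChart, fderiv_metricInChart, fderiv_metricInChart, hv X, hv Y, hN]
  rfl

set_option synthInstance.maxHeartbeats 200000 in
/-- `g(∇_X N, Y)` as a bilinear form in `X` and `Y`. -/
def covDerivForm (g : LorentzianMetric n M) (N : ∀ q : M, TangentSpace (𝓡 (n + 1)) q) (p : M) :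
    Model n →ₗ[ℝ] Model n →ₗ[ℝ] ℝ :=
  christoffelForm (chartMetric g p (extChartAt (𝓡 (n + 1)) p p))
    (fderiv ℝ (fieldInChart N p) (extChartAt (𝓡 (n + 1)) p p))
    (fderiv ℝ (chartMetric g p) (extChartAt (𝓡 (n + 1)) p p))
    (fieldInChart N p (extChartAt (𝓡 (n + 1)) p p))

theorem covDerivForm_apply (g : LorentzianMetric n M) (N : ∀ q : M, TangentSpace (𝓡 (n + 1)) q)
    (p : M) (X Y : Model n) : covDerivForm g N p X Y = covDeriv g N p X Y :=
  (covDeriv_eq g N p X Y).symm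

/-- The derivative of the unit normal field of a hypersurface, in terms of the second derivative
of a defining function. -/
theorem IsFutureUnitNormalOn.chartMetric_fderiv {g : LorentzianMetric n M} {T : TimeOrientation g}
    {S U : Set M} {N : ∀ q : M, TangentSpace (𝓡 (n + 1)) q} (hN : IsFutureUnitNormalOn T S U N)
    {p : M} (hpS : p ∈ S) (hpU : p ∈ U) {f : M → ℝ} (hf : IsDefiningFunctionAt (n := n) S p f)
    {X w : Model n}
    (hX : fderiv ℝ (f ∘ (extChartAt (𝓡 (n + 1)) p).symm) (extChartAt (𝓡 (n + 1)) p p) X = 0)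
    (hw : fderiv ℝ (f ∘ (extChartAt (𝓡 (n + 1)) p).symm) (extChartAt (𝓡 (n + 1)) p p) w ≠ 0) :
    fderiv ℝ (chartMetric g p) (extChartAt (𝓡 (n + 1)) p p) X
        (fieldInChart N p (extChartAt (𝓡 (n + 1)) p p)) X
      + chartMetric g p (extChartAt (𝓡 (n + 1)) p p)
        (fderiv ℝ (fieldInChart N p) (extChartAt (𝓡 (n + 1)) p p) X) X =
    fderiv ℝ (fderiv ℝ (f ∘ (extChartAt (𝓡 (n + 1)) p).symm)) (extChartAt (𝓡 (n + 1)) p p) X X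
      / fderiv ℝ (f ∘ (extChartAt (𝓡 (n + 1)) p).symm) (extChartAt (𝓡 (n + 1)) p p) w
      * chartMetric g p (extChartAt (𝓡 (n + 1)) p p)
        (fieldInChart N p (extChartAt (𝓡 (n + 1)) p p)) w := by
  set φ := extChartAt (𝓡 (n + 1)) p with hφ
  set F := f ∘ φ.symm with hFdef
  have hFc : ContDiffAt ℝ ∞ F (φ p) := contDiffAt_comp_chart_symm hf.contMDiffAt.self_of_nhds
  have hNc : ContDiffAt ℝ ∞ (fieldInChart N p) (φ p) :=
    contDiffAt_fieldInChart (hN.contMDiffOn.contMDiffAt (hN.isOpen.mem_nhds hpU))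
  have hF'c : ContDiffAt ℝ ∞ (fderiv ℝ F) (φ p) := hFc.fderiv_right (by simp)
  -- The product of the normal with a tangential extension of `X`. It vanishes on `S`, so its
  -- derivative along the tangent vector `X` is zero, and the product rule turns this into the
  -- asserted identity.
  set h : Model n → ℝ := fun x ↦
    chartMetric g p x (fieldInChart N p x) (X - (fderiv ℝ F x X / fderiv ℝ F x w) • w) with hh
  have hhc : ContDiffAt ℝ ∞ h (φ p) :=
    ((contDiffAt_chartMetric g p).clm_apply hNc).clm_apply
      (contDiffAt_const.sub (((hF'c.clm_apply contDiffAt_const).div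
        (hF'c.clm_apply contDiffAt_const) hw).smul contDiffAt_const))
  have hwe : ∀ᶠ x in 𝓝 (φ p), fderiv ℝ F x w ≠ 0 :=
    (hF'c.clm_apply contDiffAt_const).continuousAt.eventually_ne hw
  have hvan : ∀ᶠ x in 𝓝 (φ p), φ.symm x ∈ S → h x = 0 := by
    filter_upwards [hwe, chart_target_mem_nhds (mem_extChartAt_target (I := 𝓡 (n + 1)) p),
      (tendsto_chart_symm_self p).eventually hf.eventually,
      (tendsto_chart_symm_self p).eventually (hN.isOpen.mem_nhds hpU)] with x h1 h2 h3 h4 hxS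
    have h5 := hN.normal _ ⟨hxS, h4⟩ (mfderiv 𝓘(ℝ, Model n) (𝓡 (n + 1)) φ.symm x
      (X - (fderiv ℝ F x X / fderiv ℝ F x w) • w)) ((h3.isTangentTo_iff hxS _).2 ?_)
    · refine Eq.trans ?_ h5
      simp only [hh, chartMetric_apply, metricInChart, fieldInChart]
      rw [mfderiv_chart_symm_apply_mfderiv_chart h2]
    · refine (fderiv_comp_chart_symm h2
        (h3.contMDiffAt.self_of_nhds.mdifferentiableAt (by simp)) _).symm.trans ?_
      change fderiv ℝ F x _ = 0
      rw [map_sub, map_smul, smul_eq_mul, div_mul_cancel₀ _ h1, sub_self]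
  have hXtan : IsTangentTo S (p := p) X := (hf.isTangentTo_iff hpS X).2
    ((fderiv_comp_chart_symm_self (hf.contMDiffAt.self_of_nhds.mdifferentiableAt
      (by simp)) X).symm.trans hX)
  have hM : ContMDiffAt (𝓡 (n + 1)) 𝓘(ℝ, ℝ) ∞ (h ∘ φ) p :=
    hhc.contMDiffAt.comp p contMDiffAt_extChartAt
  have h0 := hXtan (h ∘ φ) hM (eventually_nhdsWithin_iff.2 (by
    filter_upwards [(continuousAt_extChartAt (I := 𝓡 (n + 1)) p).eventually hvan,
      extChartAt_source_mem_nhds (I := 𝓡 (n + 1)) p] with q h1 h2 h3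
    exact h1 (by rwa [φ.left_inv h2])))
  have h1 := (fderiv_comp_chart_symm_self (hM.mdifferentiableAt (by simp)) X).trans h0
  have h2 : (h ∘ φ) ∘ φ.symm =ᶠ[𝓝 (φ p)] h := by
    filter_upwards [chart_target_mem_nhds (mem_extChartAt_target (I := 𝓡 (n + 1)) p)] with x hx
    simp only [Function.comp_apply, φ.right_inv hx]
  rw [h2.fderiv_eq, fderiv_apply_tangent_field (differentiableAt_chartMetric g p)
    (hNc.differentiableAt (by simp)) (hFc.of_le (WithTop.coe_le_coe.2 le_top)) hX hw] at h1
  linarith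

end SecondFundamentalForm

/-! ### Mean curvatures of two hypersurfaces at a point of tangency -/

section MeanCurvatureComparison

section UnitNormal

variable {E : Type*} [NormedAddCommGroup E] [NormedSpace ℝ E] {G : E →L[ℝ] E →L[ℝ] ℝ}
  {ℓ : E →L[ℝ] ℝ}

theorem apply_unit_normal_ne_zero (hpos : ∀ v, ℓ v = 0 → v ≠ 0 → 0 < G v v) {N : E}
    (hN : G N N = -1) : ℓ N ≠ 0 := fun h ↦ by
  have h0 : N ≠ 0 := by
    rintro rfl
    simp at hN
  linarith [hpos N h h0]

theorem unit_normal_apply (hpos : ∀ v, ℓ v = 0 → v ≠ 0 → 0 < G v v) {N : E}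
    (hN : G N N = -1) (hperp : ∀ v, ℓ v = 0 → G N v = 0) (v : E) : G N v = -(ℓ v / ℓ N) := by
  have hne := apply_unit_normal_ne_zero hpos hN
  have h := hperp (v - (ℓ v / ℓ N) • N) (by simp [hne])
  rw [map_sub, map_smul, hN, smul_eq_mul] at h
  linarith

/-- For `t = ℓ N / ℓ N'` the vector `N - t • N'` lies in the kernel of `ℓ` and is orthogonal to it,
so positivity makes it zero. Normalization gives `t ^ 2 = 1`, and the time orientation selects `t =
1`. -/
theorem unit_normal_unique (hpos : ∀ v, ℓ v = 0 → v ≠ 0 → 0 < G v v) {N N' T : E}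
    (hN : G N N = -1) (hperp : ∀ v, ℓ v = 0 → G N v = 0) (hT : G N T < 0)
    (hN' : G N' N' = -1) (hperp' : ∀ v, ℓ v = 0 → G N' v = 0) (hT' : G N' T < 0) : N = N' := by
  have hne := apply_unit_normal_ne_zero hpos hN'
  set t := ℓ N / ℓ N' with ht
  have hZ : ℓ (N - t • N') = 0 := by simp [ht, hne]
  have hZ0 : N - t • N' = 0 := by
    by_contra h0
    have h1 := hpos _ hZ h0
    have h2 : G (N - t • N') (N - t • N') = 0 := by
      have h3 : G (N - t • N') = G N - t • G N' := by rw [map_sub, map_smul]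
      rw [h3, sub_apply, smul_apply, hperp _ hZ, hperp' _ hZ, smul_zero, sub_zero]
    linarith
  have hN2 : N = t • N' := sub_eq_zero.1 hZ0
  rw [hN2, map_smul, smul_apply, smul_eq_mul] at hT
  rw [hN2, map_smul, map_smul, smul_apply, smul_eq_mul, smul_eq_mul, hN'] at hN
  have ht0 : 0 < t := by
    by_contra h
    nlinarith [mul_nonneg_of_nonpos_of_nonpos (not_lt.1 h) hT'.le]
  have ht1 : t = 1 := by nlinarith
  rw [hN2, ht1, one_smul]

end UnitNormal

variable {n : ℕ} {M : Type*} [TopologicalSpace M]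
  [ChartedSpace (Model n) M] [IsManifold (𝓡 (n + 1)) ∞ M]

theorem IsSpacelikeHypersurface.chartMetric_pos {g : LorentzianMetric n M} {S : Set M}
    (hS : IsSpacelikeHypersurface g S) {p : M} (hp : p ∈ S) {f : M → ℝ}
    (hf : IsDefiningFunctionAt (n := n) S p f) (v : Model n)
    (hv : fderiv ℝ (f ∘ (extChartAt (𝓡 (n + 1)) p).symm) (extChartAt (𝓡 (n + 1)) p p) v = 0)
    (hv0 : v ≠ 0) : 0 < chartMetric g p (extChartAt (𝓡 (n + 1)) p p) v v := by
  have h := hS.2 p hp v ((hf.isTangentTo_iff hp v).2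
    ((fderiv_comp_chart_symm_self (hf.contMDiffAt.self_of_nhds.mdifferentiableAt
      (by simp)) v).symm.trans hv)) hv0
  exact h.trans_eq (metricInChart_self g p v v).symm

/-- The difference of the mean curvatures of two tangent spacelike hypersurfaces, in terms of the
second derivatives of their defining functions. -/
theorem HasMeanCurvatureAt.exists_sub_eq {g : LorentzianMetric n M} {T : TimeOrientation g}
    {S F : Set M} {p : M} {c θ : ℝ} (hc : HasMeanCurvatureAt T S p c)
    (hθ : HasMeanCurvatureAt T F p θ) (hS : IsSpacelikeHypersurface g S) (hpS : p ∈ S)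
    (hpF : p ∈ F) {f k : M → ℝ}
    (hf : IsDefiningFunctionAt (n := n) S p f) (hk : IsDefiningFunctionAt (n := n) F p k) {κ : ℝ}
    (hκ : fderiv ℝ (k ∘ (extChartAt (𝓡 (n + 1)) p).symm) (extChartAt (𝓡 (n + 1)) p p) =
      κ • fderiv ℝ (f ∘ (extChartAt (𝓡 (n + 1)) p).symm) (extChartAt (𝓡 (n + 1)) p p))
    (hT : 0 < fderiv ℝ (k ∘ (extChartAt (𝓡 (n + 1)) p).symm) (extChartAt (𝓡 (n + 1)) p p)
      (T.field p)) :
    ∃ μ > 0, ∃ e : Fin n → Model n,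
      (∀ i, fderiv ℝ (f ∘ (extChartAt (𝓡 (n + 1)) p).symm) (extChartAt (𝓡 (n + 1)) p p) (e i)
        = 0) ∧
      c - θ = μ * ∑ i, (κ * fderiv ℝ (fderiv ℝ (f ∘ (extChartAt (𝓡 (n + 1)) p).symm))
          (extChartAt (𝓡 (n + 1)) p p) (e i) (e i)
        - fderiv ℝ (fderiv ℝ (k ∘ (extChartAt (𝓡 (n + 1)) p).symm))
          (extChartAt (𝓡 (n + 1)) p p) (e i) (e i)) := by
  obtain ⟨U, N, e, hpU, hN, he, heo, rfl⟩ := hc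
  obtain ⟨U', N', e', hpU', hN', he', heo', rfl⟩ := hθ
  have hpos := hS.chartMetric_pos hpS hf
  have hfd := hf.contMDiffAt.self_of_nhds.mdifferentiableAt (by simp)
  have hkd := hk.contMDiffAt.self_of_nhds.mdifferentiableAt (by simp)
  have hf0 := fderiv_comp_chart_symm_ne_zero hfd hf.mfderiv_ne_zero.self_of_nhds
  have hk0 := fderiv_comp_chart_symm_ne_zero hkd hk.mfderiv_ne_zero.self_of_nhds
  have hfapp := fderiv_comp_chart_symm_self (n := n) hfd
  have hkapp := fderiv_comp_chart_symm_self (n := n) hkd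
  have hmet : ∀ u v : Model n, chartMetric g p (extChartAt (𝓡 (n + 1)) p p) u v = g.val p u v :=
    fun u v ↦ metricInChart_self g p u v
  have hNid := fun X w ↦ hN.chartMetric_fderiv hpS hpU hf (X := X) (w := w)
  have hNid' := fun X w ↦ hN'.chartMetric_fderiv hpF hpU' hk (X := X) (w := w)
  set x₀ := extChartAt (𝓡 (n + 1)) p p
  set f' := fderiv ℝ (f ∘ (extChartAt (𝓡 (n + 1)) p).symm) x₀
  set k' := fderiv ℝ (k ∘ (extChartAt (𝓡 (n + 1)) p).symm) x₀
  set G := chartMetric g p x₀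
  have hκ0 : κ ≠ 0 := by
    rintro rfl
    exact hk0 (by rw [hκ, zero_smul])
  have hker : ∀ v : Model n, k' v = 0 ↔ f' v = 0 := fun v ↦ by
    rw [hκ, smul_apply, smul_eq_mul]
    simp [hκ0]
  have htan : ∀ v : Model n, IsTangentTo S (p := p) v ↔ f' v = 0 := fun v ↦
    (hf.isTangentTo_iff hpS v).trans (by rw [hfapp v]; rfl)
  have htan' : ∀ v : Model n, IsTangentTo F (p := p) v ↔ f' v = 0 := fun v ↦
    (hk.isTangentTo_iff hpF v).trans (by rw [← hker, hkapp v]; rfl)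
  have hν : fieldInChart N p x₀ = N p := fieldInChart_self N p
  have hν' : fieldInChart N' p x₀ = N' p := fieldInChart_self N' p
  set ν := fieldInChart N p x₀
  set ν' := fieldInChart N' p x₀
  have hmet1 : ∀ v : Model n, G ν v = g.val p (N p) v := fun v ↦ by rw [hν]; exact hmet _ _
  have hmet1' : ∀ v : Model n, G ν' v = g.val p (N' p) v := fun v ↦ by rw [hν']; exact hmet _ _
  have hNN : G ν ν = -1 := (hmet1 ν).trans (by rw [hν]; exact hN.unit p ⟨hpS, hpU⟩)
  have hNN' : G ν' ν' = -1 := (hmet1' ν').trans (by rw [hν']; exact hN'.unit p ⟨hpF, hpU'⟩)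
  have hperp : ∀ v, f' v = 0 → G ν v = 0 := fun v hv ↦
    (hmet1 v).trans (hN.normal p ⟨hpS, hpU⟩ v ((htan v).2 hv))
  have hperp' : ∀ v, f' v = 0 → G ν' v = 0 := fun v hv ↦
    (hmet1' v).trans (hN'.normal p ⟨hpF, hpU'⟩ v ((htan' v).2 hv))
  obtain ⟨t, ht⟩ : ∃ t : Model n, t = T.field p := ⟨_, rfl⟩
  rw [← ht] at hT
  have hNT : G ν t < 0 := (hmet1 t).trans_lt (by rw [ht]; exact hN.future p ⟨hpS, hpU⟩)
  have hNT' : G ν' t < 0 := (hmet1' t).trans_lt (by rw [ht]; exact hN'.future p ⟨hpF, hpU'⟩)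
  have hNeq : ν = ν' := unit_normal_unique hpos hNN hperp hNT hNN' hperp' hNT'
  have hposk : ∀ v, k' v = 0 → v ≠ 0 → 0 < G v v := fun v hv ↦ hpos v ((hker v).1 hv)
  have hperpk : ∀ v, k' v = 0 → G ν v = 0 := fun v hv ↦ hperp v ((hker v).1 hv)
  have happ := unit_normal_apply hposk hNN hperpk
  -- The future normal and the orienting vector `t` lie on the same side of the tangent hyperplane,
  -- and `k` increases along `t`. This fixes the sign of the factor `μ = (k' ν)⁻¹`.
  have hkN : 0 < k' ν := by
    rw [happ, neg_lt_zero] at hNT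
    exact (div_pos_iff_of_pos_left hT).1 hNT
  obtain ⟨w, hw⟩ : ∃ w, f' w ≠ 0 := DFunLike.ne_iff.1 hf0
  have hwk : k' w ≠ 0 := fun h ↦ hw ((hker w).1 h)
  -- The Christoffel terms depend only on the common value `ν` of the normals, so only the
  -- derivatives of the normal fields contribute.
  have hdiff : ∀ X : Model n, f' X = 0 → covDeriv g N' p X X - covDeriv g N p X X =
      (k' ν)⁻¹ * (κ * fderiv ℝ (fderiv ℝ (f ∘ (extChartAt (𝓡 (n + 1)) p).symm)) x₀ X X
        - fderiv ℝ (fderiv ℝ (k ∘ (extChartAt (𝓡 (n + 1)) p).symm)) x₀ X X) := by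
    intro X hX
    have h1 := hNid X w hX hw
    have h2 := hNid' X w ((hker X).2 hX) hwk
    rw [happ] at h1
    rw [← hNeq, happ] at h2
    have h5 := covDeriv_eq g N p X X
    have h6 := covDeriv_eq g N' p X X
    change _ = G _ X + (fderiv ℝ (chartMetric g p) x₀ X ν X + fderiv ℝ (chartMetric g p) x₀ ν X X
      - fderiv ℝ (chartMetric g p) x₀ X X ν) / 2 at h5
    change _ = G _ X + (fderiv ℝ (chartMetric g p) x₀ X ν' X + fderiv ℝ (chartMetric g p) x₀ ν' X X
      - fderiv ℝ (chartMetric g p) x₀ X X ν') / 2 at h6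
    rw [← hNeq] at h6
    rw [h5, h6]
    have hkw : k' w = κ * f' w := by rw [hκ, smul_apply, smul_eq_mul]
    have h3 : ∀ a : ℝ, a / f' w * -(k' w / k' ν) = -((k' ν)⁻¹ * (κ * a)) := by
      intro a
      rw [hkw]
      field_simp
    have h4 : ∀ a : ℝ, a / k' w * -(k' w / k' ν) = -((k' ν)⁻¹ * a) := by
      intro a
      field_simp
    rw [h3] at h1
    rw [h4] at h2
    rw [mul_sub]
    linarith
  refine ⟨(k' ν)⁻¹, inv_pos.2 hkN, e, fun i ↦ (htan _).1 (he i), ?_⟩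
  -- Moves the trace for `F` to the frame `e` of `S`. With identity `A` and zero `D`,
  -- `christoffelForm` is just `G` as a bilinear form.
  have htr := sum_apply_eq_of_orthonormal (E := Model n) (by simp) (ℓ := (f' : Model n →ₗ[ℝ] ℝ))
    (fun h ↦ hw (congrArg (fun A : Model n →ₗ[ℝ] ℝ ↦ A w) h))
    (christoffelForm G (ContinuousLinearMap.id ℝ (Model n)) 0 0) (covDerivForm g N' p)
    (e := e) (e' := e') (fun i ↦ (htan _).1 (he i)) (fun i ↦ (htan' _).1 (he' i))
    (fun i j ↦ by simpa [christoffelForm, hmet] using! heo i j)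
    (fun i j ↦ by simpa [christoffelForm, hmet] using! heo' i j)
  have htr' : ∑ i, covDeriv g N' p (e i) (e i) = ∑ i, covDeriv g N' p (e' i) (e' i) := by
    have h : ∀ X : Model n, covDeriv g N' p X X = covDerivForm g N' p X X :=
      fun X ↦ (covDerivForm_apply g N' p X X).symm
    rw [Finset.sum_congr rfl fun i _ ↦ h (e i), Finset.sum_congr rfl fun i _ ↦ h (e' i)]
    exact htr
  simp only [secondFundamentalForm, Finset.sum_neg_distrib]
  rw [← htr', Finset.mul_sum, ← Finset.sum_congr rfl fun i _ ↦ hdiff (e i) ((htan _).1 (he i)),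
    Finset.sum_sub_distrib]
  ring

theorem isLocalMaxOn_comp_chart_symm {S : Set M} {p : M} {f k : M → ℝ}
    (hf : IsDefiningFunctionAt (n := n) S p f) (hp : p ∈ S) (hmax : IsLocalMaxOn k S p) :
    IsLocalMaxOn (k ∘ (extChartAt (𝓡 (n + 1)) p).symm)
      {x | (f ∘ (extChartAt (𝓡 (n + 1)) p).symm) x =
        (f ∘ (extChartAt (𝓡 (n + 1)) p).symm) (extChartAt (𝓡 (n + 1)) p p)}
      (extChartAt (𝓡 (n + 1)) p p) := by
  have hinv : (extChartAt (𝓡 (n + 1)) p).symm (extChartAt (𝓡 (n + 1)) p p) = p :=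
    extChartAt_to_inv p
  refine eventually_nhdsWithin_iff.2 ?_
  filter_upwards [(tendsto_chart_symm_self p).eventually hf.mem_iff,
    (tendsto_chart_symm_self p).eventually (eventually_nhdsWithin_iff.1 hmax)] with x h1 h2 h3
  have h4 : f ((extChartAt (𝓡 (n + 1)) p).symm x) = 0 :=
    (show _ = _ from h3).trans (by
      rw [Function.comp_apply, hinv]; exact hf.mem_iff.self_of_nhds.1 hp)
  simpa only [Function.comp_apply, hinv] using h2 (h1.2 h4)

theorem isLocalMinOn_comp_chart_symm {S : Set M} {p : M} {f k : M → ℝ}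
    (hf : IsDefiningFunctionAt (n := n) S p f) (hp : p ∈ S) (hmin : IsLocalMinOn k S p) :
    IsLocalMinOn (k ∘ (extChartAt (𝓡 (n + 1)) p).symm)
      {x | (f ∘ (extChartAt (𝓡 (n + 1)) p).symm) x =
        (f ∘ (extChartAt (𝓡 (n + 1)) p).symm) (extChartAt (𝓡 (n + 1)) p p)}
      (extChartAt (𝓡 (n + 1)) p p) := by
  simpa using! (isLocalMaxOn_comp_chart_symm hf hp hmin.neg).neg

/-- At a maximum on `S` of a function `k` that defines `F` and increases to the future, the mean
curvature of `S` is at least that of `F`. -/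
theorem HasMeanCurvatureAt.le_of_isLocalMaxOn {g : LorentzianMetric n M} {T : TimeOrientation g}
    {S F : Set M} {p : M} {c θ : ℝ} (hc : HasMeanCurvatureAt T S p c)
    (hθ : HasMeanCurvatureAt T F p θ) (hS : IsSpacelikeHypersurface g S) (hpS : p ∈ S)
    (hpF : p ∈ F) {k : M → ℝ} (hk : IsDefiningFunctionAt (n := n) F p k)
    (hT : 0 < fderiv ℝ (k ∘ (extChartAt (𝓡 (n + 1)) p).symm) (extChartAt (𝓡 (n + 1)) p p)
      (T.field p)) (hmax : IsLocalMaxOn k S p) :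
    θ ≤ c := by
  obtain ⟨f, hf⟩ := hS.1.exists_isDefiningFunctionAt hpS
  have hfc := contDiffAt_comp_chart_symm hf.contMDiffAt.self_of_nhds
  have hkc := contDiffAt_comp_chart_symm hk.contMDiffAt.self_of_nhds
  have hfd := hf.contMDiffAt.self_of_nhds.mdifferentiableAt (by simp)
  have hf0 := fderiv_comp_chart_symm_ne_zero hfd hf.mfderiv_ne_zero.self_of_nhds
  have hmax' := isLocalMaxOn_comp_chart_symm hf hpS hmax
  obtain ⟨κ, hκ⟩ := exists_multiplier (Or.inr hmax') (hfc.hasStrictFDerivAt (by simp))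
    (hkc.hasStrictFDerivAt (by simp)) hf0
  obtain ⟨μ, hμ, e, he, hce⟩ := hc.exists_sub_eq hθ hS hpS hpF hf hk hκ hT
  have : 0 ≤ c - θ := by
    rw [hce]
    refine mul_nonneg hμ.le (Finset.sum_nonneg fun i _ ↦ sub_nonneg.2 ?_)
    exact snd_fderiv_le_of_isLocalMaxOn (hfc.of_le (WithTop.coe_le_coe.2 le_top))
      (hkc.of_le (WithTop.coe_le_coe.2 le_top)) hmax' hκ hf0 (he i)
  linarith

/-- At a minimum on `S` of a function `k` that defines `F` and increases to the future, the mean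
curvature of `S` is at most that of `F`. -/
theorem HasMeanCurvatureAt.ge_of_isLocalMinOn {g : LorentzianMetric n M} {T : TimeOrientation g}
    {S F : Set M} {p : M} {c θ : ℝ} (hc : HasMeanCurvatureAt T S p c)
    (hθ : HasMeanCurvatureAt T F p θ) (hS : IsSpacelikeHypersurface g S) (hpS : p ∈ S)
    (hpF : p ∈ F) {k : M → ℝ} (hk : IsDefiningFunctionAt (n := n) F p k)
    (hT : 0 < fderiv ℝ (k ∘ (extChartAt (𝓡 (n + 1)) p).symm) (extChartAt (𝓡 (n + 1)) p p)
      (T.field p)) (hmin : IsLocalMinOn k S p) :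
    c ≤ θ := by
  obtain ⟨f, hf⟩ := hS.1.exists_isDefiningFunctionAt hpS
  have hfc := contDiffAt_comp_chart_symm hf.contMDiffAt.self_of_nhds
  have hkc := contDiffAt_comp_chart_symm hk.contMDiffAt.self_of_nhds
  have hfd := hf.contMDiffAt.self_of_nhds.mdifferentiableAt (by simp)
  have hf0 := fderiv_comp_chart_symm_ne_zero hfd hf.mfderiv_ne_zero.self_of_nhds
  have hmin' := isLocalMinOn_comp_chart_symm hf hpS hmin
  obtain ⟨κ, hκ⟩ := exists_multiplier (Or.inl hmin') (hfc.hasStrictFDerivAt (by simp))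
    (hkc.hasStrictFDerivAt (by simp)) hf0
  obtain ⟨μ, hμ, e, he, hce⟩ := hc.exists_sub_eq hθ hS hpS hpF hf hk hκ hT
  have : c - θ ≤ 0 := by
    rw [hce]
    refine mul_nonpos_of_nonneg_of_nonpos hμ.le
      (Finset.sum_nonpos fun i _ ↦ sub_nonpos.2 ?_)
    exact le_snd_fderiv_of_isLocalMinOn (hfc.of_le (WithTop.coe_le_coe.2 le_top))
      (hkc.of_le (WithTop.coe_le_coe.2 le_top)) hmin' hκ hf0 (he i)
  linarith

end MeanCurvatureComparison

section LocalFlow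

variable {n : ℕ} {M : Type*} [TopologicalSpace M]
  [ChartedSpace (Model n) M] [IsManifold (𝓡 (n + 1)) ∞ M]

/-! ### The local flow of a vector field -/

/-- Picard–Lindelöf in the chart at `p`, with starting points and times shrunk until the solutions
stay in the chart. The joint continuity is needed later for inextendibility and for openness of
saturations. -/
theorem exists_local_flow {X : ∀ q : M, TangentSpace (𝓡 (n + 1)) q}
    (hX : ContMDiff (𝓡 (n + 1)) (𝓡 (n + 1)).tangent ∞
      (fun q : M ↦ (⟨q, X q⟩ : TangentBundle (𝓡 (n + 1)) M))) (p : M) :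
    ∃ (W : Set M) (ε : ℝ) (Φ : M → ℝ → M), IsOpen W ∧ p ∈ W ∧ 0 < ε ∧
      (∀ y ∈ W, Φ y 0 = y ∧ IsMIntegralCurveOn (Φ y) X (Ioo (-ε) ε)) ∧
      ContinuousOn (Function.uncurry Φ) (W ×ˢ Ioo (-ε) ε) := by
  set φ := extChartAt (𝓡 (n + 1)) p with hφ
  have hV : ContDiffAt ℝ 1 (fieldInChart X p) (φ p) :=
    (contDiffAt_fieldInChart (hX p)).of_le (WithTop.coe_le_coe.2 le_top)
  obtain ⟨ε, hε, a, r, L, K, hr, hpl⟩ := IsPicardLindelof.of_contDiffAt_one hV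
  obtain ⟨α, hα, hαc⟩ := (hpl 0).exists_forall_mem_closedBall_eq_hasDerivWithinAt_continuousOn
  rw [zero_sub, zero_add] at hαc
  simp only [zero_sub, zero_add] at hα
  have hnhds : Metric.closedBall (φ p) r ×ˢ Icc (-ε) ε ∈ 𝓝 (φ p, (0 : ℝ)) :=
    prod_mem_nhds (Metric.closedBall_mem_nhds _ hr) (Icc_mem_nhds (by linarith) hε)
  have hα0 : α (φ p, 0) = φ p := (hα _ (Metric.mem_closedBall_self r.2)).1
  have htar : ∀ᶠ z in 𝓝 (φ p, (0 : ℝ)), α z ∈ φ.target :=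
    (hαc.continuousAt hnhds).eventually
      (by rw [hα0]; exact chart_target_mem_nhds (mem_extChartAt_target (I := 𝓡 (n + 1)) p))
  obtain ⟨δ, hδ, hball⟩ := Metric.eventually_nhds_iff_ball.1 (htar.and hnhds)
  have hball' : ∀ x ∈ Metric.ball (φ p) δ, ∀ t ∈ Ioo (-δ) δ,
      α (x, t) ∈ φ.target ∧ (x, t) ∈ Metric.closedBall (φ p) r ×ˢ Icc (-ε) ε := by
    intro x hx t ht
    refine hball (x, t) ?_
    rw [← ball_prod_same]
    exact ⟨hx, by rwa [Real.ball_eq_Ioo, zero_sub, zero_add]⟩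
  refine ⟨φ.source ∩ φ ⁻¹' Metric.ball (φ p) δ, min δ ε, fun y t ↦ φ.symm (α (φ y, t)), ?_, ?_,
    lt_min hδ hε, ?_, ?_⟩
  · exact (continuousOn_extChartAt p).isOpen_inter_preimage (isOpen_extChartAt_source p)
      Metric.isOpen_ball
  · exact ⟨mem_extChartAt_source p, Metric.mem_ball_self hδ⟩
  · rintro y ⟨hy, hy'⟩
    have hyr : φ y ∈ Metric.closedBall (φ p) r := (hball' _ hy' 0 ⟨by linarith, hδ⟩).2.1
    refine ⟨by simp only [(hα _ hyr).1, φ.left_inv hy], fun t ht ↦ ?_⟩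
    have htδ : t ∈ Ioo (-δ) δ :=
      ⟨by linarith [ht.1, min_le_left δ ε], ht.2.trans_le (min_le_left _ _)⟩
    have htε : t ∈ Ioo (-ε) ε :=
      ⟨by linarith [ht.1, min_le_right δ ε], ht.2.trans_le (min_le_right _ _)⟩
    have h1 := ((hα _ hyr).2 t (Ioo_subset_Icc_self htε)).hasDerivAt (Icc_mem_nhds htε.1 htε.2)
    have h2 := (hball' _ hy' t htδ).1
    have h3 := (mdifferentiableAt_chart_symm h2).hasMFDerivAt.comp t
      h1.hasFDerivAt.hasMFDerivAt
    refine HasMFDerivAt.hasMFDerivWithinAt ?_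
    have h4 : (mfderiv 𝓘(ℝ, Model n) (𝓡 (n + 1)) φ.symm (α (φ y, t))).comp
        (ContinuousLinearMap.toSpanSingleton ℝ (fieldInChart X p (α (φ y, t)))) =
        (1 : ℝ →L[ℝ] ℝ).smulRight (X (φ.symm (α (φ y, t)))) := ContinuousLinearMap.ext fun s ↦
      (map_smul (mfderiv 𝓘(ℝ, Model n) (𝓡 (n + 1)) φ.symm (α (φ y, t))) s
        (fieldInChart X p (α (φ y, t)))).trans
        (congrArg (s • ·) (mfderiv_chart_symm_apply_mfderiv_chart h2 _))
    exact (congrArg (HasMFDerivAt 𝓘(ℝ, ℝ) (𝓡 (n + 1)) (fun t ↦ φ.symm (α (φ y, t))) t) h4).mp h3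
  · refine (continuousOn_extChartAt_symm p).comp (hαc.comp (t := Metric.closedBall (φ p) r ×ˢ Icc (-ε) ε)
      (f := fun z : M × ℝ ↦ (φ z.1, z.2)) ?_ ?_) ?_
    · refine ContinuousOn.prodMk ?_ continuousOn_snd
      exact (continuousOn_extChartAt p).comp continuousOn_fst fun z hz ↦ hz.1.1
    · rintro z ⟨hz, hz'⟩
      exact (hball' _ hz.2 _ ⟨by linarith [hz'.1, min_le_left δ ε],
        hz'.2.trans_le (min_le_left _ _)⟩).2
    · rintro z ⟨hz, hz'⟩
      exact (hball' _ hz.2 _ ⟨by linarith [hz'.1, min_le_left δ ε],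
        hz'.2.trans_le (min_le_left _ _)⟩).1

theorem velocity_eq_of_isMIntegralCurveOn {X : ∀ q : M, TangentSpace (𝓡 (n + 1)) q} {γ : ℝ → M}
    {I : Set ℝ} (hI : IsOpen I) (hγ : IsMIntegralCurveOn γ X I) {t : ℝ} (ht : t ∈ I) :
    velocity n γ t = X (γ t) := by
  have h := ((hγ t ht).hasMFDerivAt (hI.mem_nhds ht)).mfderiv
  have h' := congrArg (fun A : ℝ →L[ℝ] TangentSpace (𝓡 (n + 1)) (γ t) ↦ A 1) h
  exact h'.trans (one_smul ℝ (X (γ t)))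

/-- In a chart the derivative of the curve is the field evaluated along a continuous curve, hence
continuous. -/
theorem contMDiffOn_of_isMIntegralCurveOn {X : ∀ q : M, TangentSpace (𝓡 (n + 1)) q}
    (hX : ContMDiff (𝓡 (n + 1)) (𝓡 (n + 1)).tangent ∞
      (fun q : M ↦ (⟨q, X q⟩ : TangentBundle (𝓡 (n + 1)) M))) {γ : ℝ → M}
    {I : Set ℝ} (hI : IsOpen I) (hγ : IsMIntegralCurveOn γ X I) :
    ContMDiffOn 𝓘(ℝ, ℝ) (𝓡 (n + 1)) 1 γ I := by
  intro t ht
  refine ContMDiffAt.contMDiffWithinAt ?_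
  have hc : ContinuousOn γ I := hγ.continuousOn
  have hct : ContinuousAt γ t := hc.continuousAt (hI.mem_nhds ht)
  set φ := extChartAt (𝓡 (n + 1)) (γ t) with hφ
  rw [contMDiffAt_iff]
  refine ⟨hct, ?_⟩
  have hV : ∀ᶠ x in 𝓝 (φ (γ t)), ContinuousAt (fieldInChart X (γ t)) x := by
    filter_upwards [((contDiffAt_fieldInChart (hX (γ t))).of_le
      (WithTop.coe_le_coe.2 (le_top (a := (1 : ℕ∞))))).eventually (by simp)] with x hx
      using hx.continuousAt
  have hφc : ContinuousAt (φ ∘ γ) t := (continuousAt_extChartAt (I := 𝓡 (n + 1)) (γ t)).comp hct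
  have hev : ∀ᶠ s in 𝓝 t, s ∈ I ∧ γ s ∈ φ.source ∧
      ContinuousAt (fieldInChart X (γ t)) (φ (γ s)) :=
    (eventually_mem_set.2 (hI.mem_nhds ht)).and (hct.eventually (extChartAt_source_mem_nhds (I := 𝓡 (n + 1)) (γ t)) |>.and
      (hφc.eventually hV))
  have hone : ContDiffAt ℝ 1 (φ ∘ γ) t := by
    rw [contDiffAt_one_iff]
    refine ⟨fun s ↦ ContinuousLinearMap.toSpanSingleton ℝ (fieldInChart X (γ t) (φ (γ s))), _, hev, ?_, ?_⟩
    · rintro s ⟨hs, hs1, hs2⟩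
      have hγs : ContinuousAt γ s := hc.continuousAt (hI.mem_nhds hs)
      have hφs : ContinuousAt φ (γ s) := continuousAt_extChartAt' hs1
      have h1 : ContinuousAt (fun s ↦ fieldInChart X (γ t) (φ (γ s))) s :=
        ContinuousAt.comp (f := fun s ↦ φ (γ s)) hs2 (hφs.comp hγs)
      exact ((ContinuousLinearMap.toSpanSingletonCLE (𝕜 := ℝ)
        (E := Model n)).continuous.continuousAt.comp h1).continuousWithinAt
    · rintro s ⟨hs, hs1, hs2⟩
      have h1 := (hγ s hs).hasMFDerivAt (hI.mem_nhds hs)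
      have h2 : MDifferentiableAt (𝓡 (n + 1)) 𝓘(ℝ, Model n) φ (γ s) :=
        mdifferentiableAt_extChartAt (by rwa [extChartAt_source] at hs1)
      have h3 := (h2.hasMFDerivAt.comp s h1).hasFDerivAt
      have h4 : (mfderiv (𝓡 (n + 1)) 𝓘(ℝ, Model n) φ (γ s) (X (γ s)) : Model n) =
          fieldInChart X (γ t) (φ (γ s)) := by
        unfold fieldInChart
        rw [φ.left_inv hs1]
        rfl
      have h5 : (mfderiv (𝓡 (n + 1)) 𝓘(ℝ, Model n) φ (γ s)).comp
          ((1 : ℝ →L[ℝ] ℝ).smulRight (X (γ s))) =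
          ContinuousLinearMap.toSpanSingleton ℝ (fieldInChart X (γ t) (φ (γ s))) :=
        ContinuousLinearMap.ext fun r ↦ (map_smul (mfderiv (𝓡 (n + 1)) 𝓘(ℝ, Model n) φ (γ s)) r
          (X (γ s))).trans (congrArg (r • ·) h4)
      exact h3.congr_fderiv h5
  simpa using! hone

end LocalFlow

section Orbits

/-! ### Orbits of a vector field -/

variable {n : ℕ} {M : Type*} [TopologicalSpace M] [T2Space M]
  [ChartedSpace (Model n) M] [IsManifold (𝓡 (n + 1)) ∞ M]
  {X : ∀ q : M, TangentSpace (𝓡 (n + 1)) q}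

theorem contMDiff_one_of_contMDiff
    (hX : ContMDiff (𝓡 (n + 1)) (𝓡 (n + 1)).tangent ∞
      (fun q : M ↦ (⟨q, X q⟩ : TangentBundle (𝓡 (n + 1)) M))) :
    ContMDiff (𝓡 (n + 1)) (𝓡 (n + 1)).tangent 1
      (fun q : M ↦ (⟨q, X q⟩ : TangentBundle (𝓡 (n + 1)) M)) :=
  hX.of_le (WithTop.coe_le_coe.2 le_top)

theorem exists_glued_integralCurve
    (hX : ContMDiff (𝓡 (n + 1)) (𝓡 (n + 1)).tangent ∞
      (fun q : M ↦ (⟨q, X q⟩ : TangentBundle (𝓡 (n + 1)) M))) {γ γ' : ℝ → M} {a b a' b' t₀ : ℝ}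
    (hγ : IsMIntegralCurveOn γ X (Ioo a b)) (hγ' : IsMIntegralCurveOn γ' X (Ioo a' b'))
    (ht : t₀ ∈ Ioo a b) (ht' : t₀ ∈ Ioo a' b') (h : γ t₀ = γ' t₀) :
    ∃ β : ℝ → M, IsMIntegralCurveOn β X (Ioo (min a a') (max b b')) ∧ EqOn β γ (Ioo a b) ∧
      EqOn β γ' (Ioo a' b') := by
  have h1 := contMDiff_one_of_contMDiff hX
  refine ⟨piecewise (Ioo a b) γ γ',
    (isMIntegralCurveOn_piecewise h1 hγ hγ' ⟨ht, ht'⟩ h).mono ?_, piecewise_eqOn _ _ _,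
    eqOn_piecewise_of_isMIntegralCurveOn_Ioo h1 hγ hγ' ⟨ht, ht'⟩ h⟩
  intro t hmem
  simp only [mem_Ioo, mem_union, min_lt_iff, lt_max_iff] at *
  grind

/-- Two points lie on a common integral curve of `X`. -/
def SameOrbit (X : ∀ q : M, TangentSpace (𝓡 (n + 1)) q) (x y : M) : Prop :=
  ∃ (γ : ℝ → M) (a b : ℝ), IsMIntegralCurveOn γ X (Ioo a b) ∧
    ∃ s ∈ Ioo a b, ∃ t ∈ Ioo a b, γ s = x ∧ γ t = y

theorem SameOrbit.symm {x y : M} (h : SameOrbit X x y) : SameOrbit X y x := by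
  obtain ⟨γ, a, b, hγ, s, hs, t, ht, hx, hy⟩ := h
  exact ⟨γ, a, b, hγ, t, ht, s, hs, hy, hx⟩

theorem isMIntegralCurveOn_shift {γ : ℝ → M} {a b : ℝ} (hγ : IsMIntegralCurveOn γ X (Ioo a b))
    (d : ℝ) : IsMIntegralCurveOn (fun t ↦ γ (t + d)) X (Ioo (a - d) (b - d)) := by
  refine (hγ.comp_add d).mono fun t ht ↦ ?_
  exact ⟨by linarith [ht.1], by linarith [ht.2]⟩

theorem SameOrbit.trans
    (hX : ContMDiff (𝓡 (n + 1)) (𝓡 (n + 1)).tangent ∞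
      (fun q : M ↦ (⟨q, X q⟩ : TangentBundle (𝓡 (n + 1)) M))) {x y z : M}
    (hxy : SameOrbit X x y) (hyz : SameOrbit X y z) : SameOrbit X x z := by
  obtain ⟨γ, a, b, hγ, s, hs, t, ht, hx, hy⟩ := hxy
  obtain ⟨γ', a', b', hγ', s', hs', t', ht', hy', hz⟩ := hyz
  obtain ⟨β, hβ, hβ1, hβ2⟩ := exists_glued_integralCurve hX hγ (isMIntegralCurveOn_shift hγ' (s' - t))
    ht (t₀ := t) ⟨by linarith [hs'.1], by linarith [hs'.2]⟩ (by simp [hy, hy'])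
  have hm : t' - (s' - t) ∈ Ioo (a' - (s' - t)) (b' - (s' - t)) :=
    ⟨by linarith [ht'.1], by linarith [ht'.2]⟩
  refine ⟨β, _, _, hβ, s, ⟨min_lt_of_left_lt hs.1, lt_max_of_lt_left hs.2⟩, t' - (s' - t),
    ⟨min_lt_of_right_lt hm.1, lt_max_of_lt_right hm.2⟩, (hβ1 hs).trans hx, ?_⟩
  rw [hβ2 hm]
  simpa using hz

/-- Every point lies on a maximal integral curve. -/
theorem exists_maximal_integralCurve
    (hX : ContMDiff (𝓡 (n + 1)) (𝓡 (n + 1)).tangent ∞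
      (fun q : M ↦ (⟨q, X q⟩ : TangentBundle (𝓡 (n + 1)) M))) (x : M) :
    ∃ (γ : ℝ → M) (D : Set ℝ), IsOpen D ∧ D.OrdConnected ∧ 0 ∈ D ∧ γ 0 = x ∧
      IsMIntegralCurveOn γ X D ∧
      (∀ t ∈ D, SameOrbit X x (γ t)) ∧ (∀ y, SameOrbit X x y → ∃ t ∈ D, γ t = y) ∧
      ∀ t ∈ D, ∀ (δ : ℝ → M) (ε : ℝ), δ 0 = γ t → IsMIntegralCurveOn δ X (Ioo (-ε) ε) →
        ∀ s ∈ Ioo (-ε) ε, t + s ∈ D ∧ γ (t + s) = δ s := by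
  classical
  have h1 := contMDiff_one_of_contMDiff hX
  -- The triple `β` is an integral curve from `x` on an open interval containing `0` and `t`. The
  -- maximal curve is the union of all of them; uniqueness makes its value at `t` independent of the
  -- chosen `β`.
  set P : ℝ → (ℝ → M) × ℝ × ℝ → Prop := fun t β ↦ (0 : ℝ) ∈ Ioo β.2.1 β.2.2 ∧
    t ∈ Ioo β.2.1 β.2.2 ∧ β.1 0 = x ∧ IsMIntegralCurveOn β.1 X (Ioo β.2.1 β.2.2) with hP
  set D : Set ℝ := {t | ∃ β, P t β} with hD
  set γ : ℝ → M := fun t ↦ if h : t ∈ D then h.choose.1 t else x with hγdef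
  have hγeq : ∀ t β, P t β → γ t = β.1 t := by
    intro t β hβ
    have htD : t ∈ D := ⟨β, hβ⟩
    rw [hγdef]
    simp only [dif_pos htD]
    obtain ⟨h0, ht, hx, hc⟩ := htD.choose_spec
    obtain ⟨h0', ht', hx', hc'⟩ := hβ
    set α := htD.choose
    refine isMIntegralCurveOn_Ioo_eqOn_of_contMDiff_boundaryless (t₀ := 0)
      (a := max α.2.1 β.2.1) (b := min α.2.2 β.2.2) ⟨max_lt h0.1 h0'.1, lt_min h0.2 h0'.2⟩ h1
      (hc.mono (Ioo_subset_Ioo (le_max_left _ _) (min_le_left _ _)))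
      (hc'.mono (Ioo_subset_Ioo (le_max_right _ _) (min_le_right _ _))) (hx.trans hx'.symm)
      ⟨max_lt ht.1 ht'.1, lt_min ht.2 ht'.2⟩
  have hPD : ∀ {t β}, P t β → Ioo β.2.1 β.2.2 ⊆ D ∧ EqOn γ β.1 (Ioo β.2.1 β.2.2) := by
    intro t β hβ
    have : ∀ s ∈ Ioo β.2.1 β.2.2, P s β := fun s hs ↦ ⟨hβ.1, hs, hβ.2.2⟩
    exact ⟨fun s hs ↦ ⟨β, this s hs⟩, fun s hs ↦ hγeq s β (this s hs)⟩
  obtain ⟨W, ε, Φ, -, hxW, hε, hΦ, -⟩ := exists_local_flow hX x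
  have hP0 : P 0 (Φ x, -ε, ε) :=
    ⟨⟨by simpa using hε, hε⟩, ⟨by simpa using hε, hε⟩, (hΦ x hxW).1, (hΦ x hxW).2⟩
  have hγ0 : γ 0 = x := (hγeq 0 _ hP0).trans (hΦ x hxW).1
  refine ⟨γ, D, ?_, ?_, ⟨_, hP0⟩, hγ0, ?_, ?_, ?_, ?_⟩
  · refine isOpen_iff_mem_nhds.2 fun t ⟨β, hβ⟩ ↦ ?_
    exact mem_of_superset (isOpen_Ioo.mem_nhds hβ.2.1) (hPD hβ).1
  · refine ordConnected_of_uIcc_subset_left (x := 0) ?_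
    rintro t ⟨β, hβ⟩
    exact (ordConnected_Ioo.uIcc_subset hβ.1 hβ.2.1).trans (hPD hβ).1
  · rintro t ⟨β, hβ⟩
    have h2 := (hβ.2.2.2 t hβ.2.1).hasMFDerivAt (isOpen_Ioo.mem_nhds hβ.2.1)
    rw [← hγeq t β hβ] at h2
    refine (h2.congr_of_eventuallyEq ?_).hasMFDerivWithinAt
    exact mem_of_superset (isOpen_Ioo.mem_nhds hβ.2.1) (hPD hβ).2
  · rintro t ⟨β, hβ⟩
    exact ⟨β.1, _, _, hβ.2.2.2, 0, hβ.1, t, hβ.2.1, hβ.2.2.1, (hγeq t β hβ).symm⟩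
  · rintro y ⟨α, a, b, hα, s, hs, t, ht, hx, hy⟩
    have hPt : P (t - s) (fun r ↦ α (r + s), a - s, b - s) :=
      ⟨⟨by linarith [hs.1], by linarith [hs.2]⟩, ⟨by linarith [ht.1], by linarith [ht.2]⟩,
        by simpa using hx, isMIntegralCurveOn_shift hα s⟩
    exact ⟨t - s, ⟨_, hPt⟩, (hγeq _ _ hPt).trans (by simpa using hy)⟩
  · rintro t ⟨β, hβ⟩ δ ε hδ0 hδ s hs
    have hε : 0 < ε := by linarith [hs.1, hs.2]
    have hδ' := isMIntegralCurveOn_shift hδ (-t)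
    have hm : t ∈ Ioo (-ε - -t) (ε - -t) := ⟨by linarith, by linarith⟩
    obtain ⟨κ, hκ, hκ1, hκ2⟩ := exists_glued_integralCurve hX hβ.2.2.2 hδ' hβ.2.1 hm
      (by rw [add_neg_cancel, hδ0]; exact (hγeq t β hβ).symm)
    have hs' : t + s ∈ Ioo (-ε - -t) (ε - -t) := ⟨by linarith [hs.1], by linarith [hs.2]⟩
    have hPs : P (t + s) (κ, min β.2.1 (-ε - -t), max β.2.2 (ε - -t)) :=
      ⟨⟨min_lt_of_left_lt hβ.1.1, lt_max_of_lt_left hβ.1.2⟩,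
        ⟨min_lt_of_right_lt hs'.1, lt_max_of_lt_right hs'.2⟩,
        (hκ1 hβ.1).trans hβ.2.2.1, hκ⟩
    refine ⟨⟨_, hPs⟩, (hγeq _ _ hPs).trans ((hκ2 hs').trans ?_)⟩
    simp

/-- A maximal integral curve along which some function strictly increases has no limit. -/
theorem not_exists_tendsto_of_maximal
    (hX : ContMDiff (𝓡 (n + 1)) (𝓡 (n + 1)).tangent ∞
      (fun q : M ↦ (⟨q, X q⟩ : TangentBundle (𝓡 (n + 1)) M))) {τ : M → ℝ}
    (hτ : ∀ (γ : ℝ → M) (a b : ℝ), a < b → IsMIntegralCurveOn γ X (Ioo a b) →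
      StrictMonoOn (τ ∘ γ) (Ioo a b))
    {γ : ℝ → M} {D : Set ℝ}
    (hmax : ∀ t ∈ D, ∀ (δ : ℝ → M) (ε : ℝ), δ 0 = γ t → IsMIntegralCurveOn δ X (Ioo (-ε) ε) →
        ∀ s ∈ Ioo (-ε) ε, t + s ∈ D ∧ γ (t + s) = δ s)
    {l : Filter D} [l.NeBot] {σ : ℝ} (hσ : σ ≠ 0)
    (hl : ∀ (e : D → D), (∀ t, e t = t ∨ ∃ r > 0, (e t : ℝ) = t + r * σ) → Tendsto e l l) :
    ¬ ∃ p : M, Tendsto (fun t : D ↦ γ t) l (𝓝 p) := by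
  classical
  rintro ⟨p, hp⟩
  obtain ⟨W, ε, Φ, hW, hpW, hε, hΦ, hΦc⟩ := exists_local_flow hX p
  obtain ⟨r, hr, hs⟩ : ∃ r > 0, r * σ ∈ Ioo (-ε) ε := by
    refine ⟨ε / 2 / |σ|, by positivity, ?_⟩
    rw [mem_Ioo, ← abs_lt, abs_mul, abs_div, abs_abs, div_mul_cancel₀ _ (abs_ne_zero.2 hσ),
      abs_of_pos (by positivity)]
    linarith
  set s := r * σ
  -- Translation by `s`, towards the end of `D` given by the sign of `σ`. Near the limit `p` the
  -- flow time is uniform, so maximality makes the translation eventually defined. Then `γ (t + s)`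
  -- tends both to `p` and to `Φ p s`, which contradicts strict monotonicity along the orbit of `p`.
  set e : D → D := fun t ↦ if h : (t : ℝ) + s ∈ D then ⟨t + s, h⟩ else t with he
  have hel : Tendsto e l l := hl e fun t ↦ by
    by_cases h : (t : ℝ) + s ∈ D
    · exact Or.inr ⟨r, hr, by simp [he, h, s]⟩
    · exact Or.inl (by simp [he, h])
  have h1 : Tendsto (fun t : D ↦ γ (e t)) l (𝓝 p) := hp.comp hel
  have hcont : ContinuousAt (fun y ↦ Φ y s) p := by
    have h2 : ContinuousAt (Function.uncurry Φ) (p, s) :=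
      hΦc.continuousAt ((hW.prod isOpen_Ioo).mem_nhds ⟨hpW, hs⟩)
    exact ContinuousAt.comp (f := fun y ↦ (y, s)) h2 (by fun_prop)
  have h2 : Tendsto (fun t : D ↦ γ (e t)) l (𝓝 (Φ p s)) := by
    refine (hcont.tendsto.comp hp).congr' ?_
    filter_upwards [hp.eventually (hW.mem_nhds hpW)] with t ht
    obtain ⟨h3, h4⟩ := hmax t t.2 (Φ (γ t)) ε (hΦ _ ht).1 (hΦ _ ht).2 s hs
    have h5 : (e t : ℝ) = t + s := by simp [he, h3]
    rw [h5, h4]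
    rfl
  have h3 : Φ p s = Φ p 0 := (tendsto_nhds_unique h2 h1).trans (hΦ p hpW).1.symm
  have h0 : (0 : ℝ) ∈ Ioo (-ε) ε := ⟨by linarith, hε⟩
  have := (hτ (Φ p) _ _ (by linarith) (hΦ p hpW).2).injOn hs h0 (by simp [h3])
  exact mul_ne_zero hr.ne' hσ this

theorem isInextendible_of_maximal
    (hX : ContMDiff (𝓡 (n + 1)) (𝓡 (n + 1)).tangent ∞
      (fun q : M ↦ (⟨q, X q⟩ : TangentBundle (𝓡 (n + 1)) M))) {τ : M → ℝ}
    (hτ : ∀ (γ : ℝ → M) (a b : ℝ), a < b → IsMIntegralCurveOn γ X (Ioo a b) →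
      StrictMonoOn (τ ∘ γ) (Ioo a b))
    {γ : ℝ → M} {D : Set ℝ} (hD : D.Nonempty)
    (hmax : ∀ t ∈ D, ∀ (δ : ℝ → M) (ε : ℝ), δ 0 = γ t → IsMIntegralCurveOn δ X (Ioo (-ε) ε) →
        ∀ s ∈ Ioo (-ε) ε, t + s ∈ D ∧ γ (t + s) = δ s) : IsInextendible γ D := by
  have : Nonempty D := hD.to_subtype
  refine ⟨not_exists_tendsto_of_maximal hX hτ hmax (σ := 1) one_ne_zero fun e he ↦ ?_,
    not_exists_tendsto_of_maximal hX hτ hmax (σ := -1) (by norm_num) fun e he ↦ ?_⟩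
  · refine tendsto_atTop_mono (fun t ↦ ?_) tendsto_id
    rcases he t with h | ⟨r, hr, h⟩
    · exact h.ge
    · exact Subtype.coe_le_coe.1 (by rw [h]; simp only [id]; linarith)
  · refine tendsto_atBot_mono (fun t ↦ ?_) tendsto_id
    rcases he t with h | ⟨r, hr, h⟩
    · exact h.le
    · exact Subtype.coe_le_coe.1 (by rw [h]; simp only [id]; linarith)

/-! ### Openness of the union of orbits through a transverse set -/

theorem exists_neg_and_pos_of_hasDerivAt {h : ℝ → ℝ} {c : ℝ} (hh : HasDerivAt h c 0) (hc : c ≠ 0)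
    (h0 : h 0 = 0) {δ : ℝ} (hδ : 0 < δ) :
    ∃ s ∈ Ioo (-δ) δ, ∃ t ∈ Ioo (-δ) δ, h s < 0 ∧ 0 < h t := by
  wlog hpos : 0 < c generalizing h c
  · obtain ⟨s, hs, t, ht, h1, h2⟩ := this hh.neg (neg_ne_zero.2 hc) (by simpa using h0)
      (neg_pos.2 (lt_of_le_of_ne (not_lt.1 hpos) hc))
    exact ⟨t, ht, s, hs, by simpa using h2, by simpa using h1⟩
  have hmem : ∀ᶠ t in 𝓝[>] (0 : ℝ), t ∈ Ioo 0 δ := Ioo_mem_nhdsGT hδ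
  obtain ⟨t, ht, htδ⟩ := ((eventually_lt_of_hasDerivAt_pos hh hpos).and hmem).exists
  have hh' : HasDerivAt (fun t ↦ -h (-t)) c 0 := by
    have h1 : HasDerivAt h c (-0) := by simpa using hh
    have h2 : HasDerivAt (h ∘ Neg.neg) (c * -1) 0 := h1.comp (0 : ℝ) (hasDerivAt_neg 0)
    have h3 := h2.neg
    rw [mul_neg_one, neg_neg] at h3
    exact h3
  obtain ⟨s, hs, hsδ⟩ := ((eventually_lt_of_hasDerivAt_pos hh' hpos).and hmem).exists
  refine ⟨-s, ⟨by linarith [hsδ.2], by linarith [hsδ.1]⟩, t, ⟨by linarith [htδ.1], htδ.2⟩, ?_, ?_⟩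
  · simp only [neg_zero, h0] at hs
    linarith
  · rwa [h0] at ht

theorem hasDerivAt_comp_of_isMIntegralCurveOn {γ : ℝ → M} {D : Set ℝ} {f : M → ℝ} {t : ℝ}
    (hD : IsOpen D) (hγ : IsMIntegralCurveOn γ X D) (ht : t ∈ D)
    (hf : MDifferentiableAt (𝓡 (n + 1)) 𝓘(ℝ, ℝ) f (γ t)) :
    HasDerivAt (fun s ↦ f (γ s)) (mfderiv (𝓡 (n + 1)) 𝓘(ℝ, ℝ) f (γ t) (X (γ t))) t := by
  have h1 := (hγ t ht).hasMFDerivAt (hD.mem_nhds ht)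
  have h2 : ∀ B : ℝ →L[ℝ] ℝ, HasFDerivAt (fun s ↦ f (γ s)) B t →
      HasDerivAt (fun s ↦ f (γ s)) (B 1) t := fun B hB ↦ hB.hasDerivAt
  refine (h2 _ (hf.hasMFDerivAt.comp t h1).hasFDerivAt).congr_deriv ?_
  exact congrArg (mfderiv (𝓡 (n + 1)) 𝓘(ℝ, ℝ) f (γ t)) (one_smul ℝ (X (γ t)))

/-- The points whose orbit meets `S` near a point of `S` transverse to `X` form a neighbourhood. -/
theorem saturation_mem_nhds
    (hX : ContMDiff (𝓡 (n + 1)) (𝓡 (n + 1)).tangent ∞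
      (fun q : M ↦ (⟨q, X q⟩ : TangentBundle (𝓡 (n + 1)) M))) {S : Set M} {p : M} (hp : p ∈ S)
    {f : M → ℝ} (hf : IsDefiningFunctionAt (n := n) S p f)
    (hfX : mfderiv (𝓡 (n + 1)) 𝓘(ℝ, ℝ) f p (X p) ≠ (0 : ℝ)) :
    {y | ∃ σ ∈ S, SameOrbit X y σ} ∈ 𝓝 p := by
  obtain ⟨W, ε, Φ, hW, hpW, hε, hΦ, hΦc⟩ := exists_local_flow hX p
  have h0ε : (0 : ℝ) ∈ Ioo (-ε) ε := ⟨by linarith, hε⟩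
  have hcont : ∀ y ∈ W, ∀ t ∈ Ioo (-ε) ε, ContinuousAt (Function.uncurry Φ) (y, t) :=
    fun y hy t ht ↦ hΦc.continuousAt ((hW.prod isOpen_Ioo).mem_nhds ⟨hy, ht⟩)
  have hΦp := (hΦ p hpW).1
  have hev : ∀ᶠ z in 𝓝 (p, (0 : ℝ)), (z.1 ∈ W ∧ z.2 ∈ Ioo (-ε) ε) ∧
      (Φ z.1 z.2 ∈ S ↔ f (Φ z.1 z.2) = 0) ∧ ContinuousAt f (Φ z.1 z.2) := by
    refine (eventually_mem_set.2 ((hW.prod isOpen_Ioo).mem_nhds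
      (show (p, (0 : ℝ)) ∈ W ×ˢ Ioo (-ε) ε from ⟨hpW, h0ε⟩))).and
      ((hcont p hpW 0 h0ε).eventually (p := fun q ↦ (q ∈ S ↔ f q = 0) ∧ ContinuousAt f q) ?_)
    rw [Function.uncurry_apply_pair, hΦp]
    filter_upwards [hf.mem_iff, hf.contMDiffAt] with q h1 h2 using ⟨h1, h2.continuousAt⟩
  rw [nhds_prod_eq] at hev
  obtain ⟨V, hV, J, hJ, hVJ⟩ := eventually_prod_iff.1 hev
  obtain ⟨δ, hδ, hJδ⟩ := Metric.eventually_nhds_iff.1 hJ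
  have hJ' : ∀ t ∈ Ioo (-δ) δ, J t := fun t ht ↦ hJδ (by simpa [abs_lt] using ht)
  have hder : HasDerivAt (fun t ↦ f (Φ p t)) (mfderiv (𝓡 (n + 1)) 𝓘(ℝ, ℝ) f p (X p)) 0 := by
    have h1 := hasDerivAt_comp_of_isMIntegralCurveOn (f := f) isOpen_Ioo (hΦ p hpW).2 h0ε
      (by rw [hΦp]; exact hf.contMDiffAt.self_of_nhds.mdifferentiableAt (by simp))
    rwa [hΦp] at h1
  -- By transversality `f` changes sign along the orbit of `p`. The strict signs at the fixed times
  -- `s₁`, `s₂` persist for nearby starting points, whose orbits therefore cross `S` in between.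
  obtain ⟨s₁, hs₁, s₂, hs₂, hneg, hpos⟩ := exists_neg_and_pos_of_hasDerivAt hder hfX
    (by simpa only [hΦp] using hf.mem_iff.self_of_nhds.1 hp) hδ
  have hcy : ∀ s ∈ Ioo (-δ) δ, ContinuousAt (fun y ↦ f (Φ y s)) p := by
    intro s hs
    have h1 := hVJ hV.self_of_nhds (hJ' s hs)
    have h2 : ContinuousAt (fun y ↦ Φ y s) p :=
      ContinuousAt.comp (f := fun y ↦ (y, s)) (hcont p hpW s h1.1.2) (by fun_prop)
    exact ContinuousAt.comp (g := f) h1.2.2 h2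
  filter_upwards [hV, (hcy s₁ hs₁).eventually_lt_const hneg,
    (hcy s₂ hs₂).eventually_const_lt hpos] with y hy hy₁ hy₂
  have hsub : uIcc s₁ s₂ ⊆ Ioo (-δ) δ := ordConnected_Ioo.uIcc_subset hs₁ hs₂
  have hfc : ContinuousOn (fun t ↦ f (Φ y t)) (uIcc s₁ s₂) := by
    intro t ht
    have h1 := hVJ hy (hJ' t (hsub ht))
    have h2 : ContinuousAt (fun t ↦ Φ y t) t :=
      ContinuousAt.comp (f := fun t ↦ (y, t)) (hcont y h1.1.1 t h1.1.2) (by fun_prop)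
    exact (ContinuousAt.comp (g := f) h1.2.2 h2).continuousWithinAt
  obtain ⟨t, ht, ht0⟩ := intermediate_value_uIcc hfc (mem_uIcc.2 (Or.inl ⟨hy₁.le, hy₂.le⟩))
  have h1 := hVJ hy (hJ' t (hsub ht))
  exact ⟨Φ y t, h1.2.1.2 ht0, Φ y, -ε, ε, (hΦ y h1.1.1).2, 0, h0ε, t, h1.1.2,
    (hΦ y h1.1.1).1, rfl⟩

/-- Carries openness along an orbit from its point on `S` to any other point. The local flow
provides such a map between nearby times, such maps compose, and connectedness of the time interval
does the rest. -/
theorem SameOrbit.exists_continuousAt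
    (hX : ContMDiff (𝓡 (n + 1)) (𝓡 (n + 1)).tangent ∞
      (fun q : M ↦ (⟨q, X q⟩ : TangentBundle (𝓡 (n + 1)) M))) {x z : M}
    (h : SameOrbit X x z) :
    ∃ F : M → M, ContinuousAt F x ∧ F x = z ∧ ∀ᶠ y in 𝓝 x, SameOrbit X y (F y) := by
  obtain ⟨γ, a, b, hγ, s, hs, t, ht, rfl, rfl⟩ := h
  refine isPreconnected_Ioo.induction₂' (fun u v ↦ ∃ F : M → M, ContinuousAt F (γ u) ∧
    F (γ u) = γ v ∧ ∀ᶠ y in 𝓝 (γ u), SameOrbit X y (F y)) ?_ ?_ hs ht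
  · intro u hu
    obtain ⟨W, ε, Φ, hW, huW, hε, hΦ, hΦc⟩ := exists_local_flow hX (γ u)
    have key : ∀ v ∈ Ioo a b, ∀ w ∈ Ioo a b, γ v ∈ W → w - v ∈ Ioo (-ε) ε →
        ∃ F : M → M, ContinuousAt F (γ v) ∧ F (γ v) = γ w ∧
          ∀ᶠ y in 𝓝 (γ v), SameOrbit X y (F y) := by
      intro v hv w hw hvW hε'
      refine ⟨fun y ↦ Φ y (w - v), ?_, ?_, ?_⟩
      · have h2 : ContinuousAt (Function.uncurry Φ) (γ v, w - v) :=
          hΦc.continuousAt ((hW.prod isOpen_Ioo).mem_nhds ⟨hvW, hε'⟩)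
        exact ContinuousAt.comp (f := fun y ↦ (y, w - v)) h2 (by fun_prop)
      · obtain ⟨β, -, h1, h2⟩ := exists_glued_integralCurve hX hγ
          (isMIntegralCurveOn_shift (hΦ _ hvW).2 (-v)) hv
          ⟨by linarith, by linarith⟩ (by simp [(hΦ _ hvW).1])
        have h3 := h2 (x := w) ⟨by linarith [hε'.1], by linarith [hε'.2]⟩
        rw [h1 hw] at h3
        simpa [sub_eq_add_neg] using h3.symm
      · filter_upwards [hW.mem_nhds hvW] with y hy
        exact ⟨Φ y, -ε, ε, (hΦ y hy).2, 0, ⟨by linarith, hε⟩, _, hε', (hΦ y hy).1, rfl⟩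
    have hγu : ContinuousWithinAt γ (Ioo a b) u := (hγ u hu).continuousWithinAt
    filter_upwards [self_mem_nhdsWithin, hγu (hW.mem_nhds huW),
      mem_nhdsWithin_of_mem_nhds (Ioo_mem_nhds (sub_lt_self u hε) (lt_add_of_pos_right u hε))]
      with v hv hvW hvε
    exact ⟨key u hu v hv huW ⟨by linarith [hvε.1], by linarith [hvε.2]⟩,
      key v hv u hu hvW ⟨by linarith [hvε.2], by linarith [hvε.1]⟩⟩
  · rintro u v w hu hv hw ⟨F, hF, hFu, hF'⟩ ⟨G, hG, hGv, hG'⟩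
    rw [← hFu] at hG hG'
    refine ⟨G ∘ F, hG.comp hF, by simp [hFu, hGv], ?_⟩
    filter_upwards [hF', hF.eventually hG'] with y h1 h2 using h1.trans hX h2

/-- The set of points whose orbit meets a set transverse to `X` is open. -/
theorem isOpen_saturation
    (hX : ContMDiff (𝓡 (n + 1)) (𝓡 (n + 1)).tangent ∞
      (fun q : M ↦ (⟨q, X q⟩ : TangentBundle (𝓡 (n + 1)) M))) {S : Set M}
    (hS : ∀ p ∈ S, ∃ f : M → ℝ, IsDefiningFunctionAt (n := n) S p f ∧
      mfderiv (𝓡 (n + 1)) 𝓘(ℝ, ℝ) f p (X p) ≠ (0 : ℝ)) :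
    IsOpen {y | ∃ σ ∈ S, SameOrbit X y σ} := by
  refine isOpen_iff_mem_nhds.2 ?_
  rintro x ⟨σ, hσ, hxσ⟩
  obtain ⟨f, hf, hfX⟩ := hS σ hσ
  obtain ⟨F, hF, rfl, hF'⟩ := hxσ.exists_continuousAt hX
  filter_upwards [hF', hF.eventually (eventually_mem_set.2 (saturation_mem_nhds hX hσ hf hfX))]
    with y h1 ⟨σ', hσ', h2⟩
  exact ⟨σ', hσ', h1.trans hX h2⟩

end Orbits

section Projection

/-! ### Hypersurfaces transverse to the time orientation -/

variable {n : ℕ} {M : Type*} [TopologicalSpace M] [T2Space M]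
  [ChartedSpace (Model n) M] [IsManifold (𝓡 (n + 1)) ∞ M]
  {g : LorentzianMetric n M} (T : TimeOrientation g)

theorem TimeOrientation.field_ne_zero (p : M) : T.field p ≠ 0 := by
  intro h
  have := T.timelike p
  rw [h] at this
  simp at this

theorem TimeOrientation.isCurveOn {γ : ℝ → M} {D : Set ℝ} (hD : IsOpen D) (hD' : D.OrdConnected)
    (hne : D.Nonempty) (hγ : IsMIntegralCurveOn γ T.field D) : IsCurveOn n γ D :=
  ⟨hD, hD', hne, contMDiffOn_of_isMIntegralCurveOn T.contMDiff hD hγ⟩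

theorem TimeOrientation.isCausalCurve {γ : ℝ → M} {D : Set ℝ} (hD : IsOpen D)
    (hD' : D.OrdConnected) (hne : D.Nonempty) (hγ : IsMIntegralCurveOn γ T.field D) :
    IsCausalCurve g γ D := by
  refine ⟨T.isCurveOn hD hD' hne hγ, fun t ht ↦ ?_⟩
  rw [velocity_eq_of_isMIntegralCurveOn hD hγ ht]
  exact ⟨T.field_ne_zero _, (T.timelike _).le⟩

theorem TimeOrientation.isFutureTimelikeCurve {γ : ℝ → M} {D : Set ℝ} (hD : IsOpen D)
    (hD' : D.OrdConnected) (hne : D.Nonempty) (hγ : IsMIntegralCurveOn γ T.field D) :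
    IsFutureTimelikeCurve T γ D := by
  refine ⟨T.isCurveOn hD hD' hne hγ, fun t ht ↦ ?_⟩
  rw [velocity_eq_of_isMIntegralCurveOn hD hγ ht]
  exact ⟨T.timelike _, T.timelike _⟩

variable {T}

theorem IsTimeFunction.strictMonoOn {τ : M → ℝ} (hτ : IsTimeFunction T τ) {γ : ℝ → M} {a b : ℝ}
    (hab : a < b) (hγ : IsMIntegralCurveOn γ T.field (Ioo a b)) :
    StrictMonoOn (τ ∘ γ) (Ioo a b) :=
  hτ.2 γ _ (T.isFutureTimelikeCurve isOpen_Ioo ordConnected_Ioo (nonempty_Ioo.2 hab) hγ)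

variable (T) in
-- A timelike vector is never tangent to a spacelike hypersurface.
theorem IsSpacelikeHypersurface.mfderiv_field_ne_zero {S : Set M}
    (hS : IsSpacelikeHypersurface g S) {p : M} (hp : p ∈ S) {f : M → ℝ}
    (hf : IsDefiningFunctionAt (n := n) S p f) :
    mfderiv (𝓡 (n + 1)) 𝓘(ℝ, ℝ) f p (T.field p) ≠ (0 : ℝ) := fun h ↦
  (hS.2 p hp _ ((hf.isTangentTo_iff hp _).2 h) (T.field_ne_zero p)).not_gt (T.timelike p)

theorem IsTimeFunction.isDefiningFunctionAt {τ : M → ℝ} (hτ : IsTimeFunction T τ) (p : M) (θ : ℝ) :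
    IsDefiningFunctionAt (n := n) (τ ⁻¹' {θ}) p (fun q ↦ τ q - θ) := by
  refine ⟨.of_forall fun q ↦ (hτ.1.contMDiff q).sub contMDiffAt_const,
    .of_forall fun q ↦ by simp [sub_eq_zero], .of_forall fun q h ↦
      mfderiv_ne_zero_of_isSubmersion hτ.1 q (Eq.trans ?_ h)⟩
  have hd := ((hτ.1.contMDiff q).mdifferentiableAt (by simp)).hasMFDerivAt
  have h2 := (hd.sub (hasMFDerivAt_const θ q)).mfderiv
  refine Eq.trans ?_ h2.symm
  exact (sub_zero _).symm

/-- Monotonicity along integral curves gives only a nonnegative derivative; it is nonzero because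
the fiber is spacelike and the field timelike. -/
theorem IsCMCTimeFunction.fderiv_field_pos {τ : M → ℝ} (hτ : IsCMCTimeFunction T τ) (p : M) :
    0 < fderiv ℝ ((fun q ↦ τ q - τ p) ∘ (extChartAt (𝓡 (n + 1)) p).symm)
      (extChartAt (𝓡 (n + 1)) p p) (T.field p) := by
  have hk := hτ.1.isDefiningFunctionAt p (τ p)
  have hkd := hk.contMDiffAt.self_of_nhds.mdifferentiableAt (by simp)
  refine lt_of_lt_of_eq ?_ (fderiv_comp_chart_symm_self hkd _).symm
  refine lt_of_le_of_ne ?_ ((hτ.2 (τ p)).1.mfderiv_field_ne_zero T rfl hk).symm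
  obtain ⟨W, ε, Φ, -, hpW, hε, hΦ, -⟩ := exists_local_flow T.contMDiff p
  obtain ⟨h0, hΦp⟩ := hΦ p hpW
  have h0ε : (0 : ℝ) ∈ Ioo (-ε) ε := ⟨by linarith, hε⟩
  have hder := hasDerivAt_comp_of_isMIntegralCurveOn (f := fun q ↦ τ q - τ p) isOpen_Ioo hΦp h0ε
    (by rwa [h0])
  rw [h0] at hder
  have hmono := (hτ.1.strictMonoOn (by linarith) hΦp).monotoneOn
  refine le_of_not_gt fun hneg : (_ : ℝ) < 0 ↦ ?_
  have hev := eventually_lt_of_hasDerivAt_pos hder.neg (neg_pos.2 hneg)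
  obtain ⟨t, ht, htε⟩ := (hev.and (eventually_mem_set.2 (Ioo_mem_nhdsGT hε))).exists
  have := hmono h0ε ⟨by linarith [htε.1], htε.2⟩ htε.1.le
  simp at ht this
  linarith

/-- A compact spacelike hypersurface of constant mean curvature lies in a fiber of a CMC time
function. -/
theorem IsCMCTimeFunction.eq_of_mem_of_hasConstantMeanCurvature {τ : M → ℝ} (hτ : IsCMCTimeFunction T τ) {S : Set M}
    (hS : IsCompact S) (hne : S.Nonempty) {c : ℝ} (hc : HasConstantMeanCurvature T S c) :
    ∀ q ∈ S, τ q = c := by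
  have hcont : ContinuousOn τ S := hτ.1.1.contMDiff.continuous.continuousOn
  obtain ⟨p, hp, hmax⟩ := hS.exists_isMaxOn hne hcont
  obtain ⟨q, hq, hmin⟩ := hS.exists_isMinOn hne hcont
  have h1 : τ p ≤ c := (hc.2 p hp).le_of_isLocalMaxOn ((hτ.2 (τ p)).2 p rfl) hc.1 hp rfl
    (hτ.1.isDefiningFunctionAt p (τ p)) (hτ.fderiv_field_pos p)
    (IsMaxOn.localize fun y hy ↦ show τ y - τ p ≤ τ p - τ p from
      sub_le_sub_right (hmax hy) _)
  have h2 : c ≤ τ q := (hc.2 q hq).ge_of_isLocalMinOn ((hτ.2 (τ q)).2 q rfl) hc.1 hq rfl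
    (hτ.1.isDefiningFunctionAt q (τ q)) (hτ.fderiv_field_pos q)
    (IsMinOn.localize fun y hy ↦ show τ q - τ q ≤ τ y - τ q from
      sub_le_sub_right (hmin hy) _)
  exact fun y hy ↦ le_antisymm ((hmax hy).trans h1) (h2.trans (hmin hy))

theorem IsSpacelikeHypersurface.isOpen_saturation_inter {S V : Set M}
    (hS : IsSpacelikeHypersurface g S) (hV : IsOpen V) :
    IsOpen {y | ∃ σ ∈ S ∩ V, SameOrbit T.field y σ} := by
  refine isOpen_saturation T.contMDiff fun p ⟨hp, hpV⟩ ↦ ?_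
  obtain ⟨f, hf⟩ := hS.1.exists_isDefiningFunctionAt hp
  refine ⟨f, ⟨hf.contMDiffAt, ?_, hf.mfderiv_ne_zero⟩, hS.mfderiv_field_ne_zero T hp hf⟩
  filter_upwards [hf.mem_iff, hV.mem_nhds hpV] with q h1 h2
  simp [← h1, h2]

/-- The projection to a Cauchy surface along the orbits of the time orientation. -/
theorem IsCauchySurface.exists_projection {τ : M → ℝ} (hτ : IsTimeFunction T τ) {C : Set M}
    (hC : IsCauchySurface g C) :
    ∃ r : M → M, Continuous r ∧ (∀ x, r x ∈ C ∧ SameOrbit T.field x (r x)) ∧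
      ∀ x, ∀ y ∈ C, SameOrbit T.field x y → y = r x := by
  have key : ∀ x, ∃ z, (z ∈ C ∧ SameOrbit T.field x z) ∧
      ∀ y ∈ C, SameOrbit T.field x y → y = z := by
    intro x
    obtain ⟨γ, D, hD, hD', h0, -, hγ, horb, hsurj, hmax⟩ := exists_maximal_integralCurve T.contMDiff x
    obtain ⟨t, ⟨ht, htC⟩, huniq⟩ := hC.2 γ D (T.isCausalCurve hD hD' ⟨0, h0⟩ hγ)
      (isInextendible_of_maximal T.contMDiff (fun _ _ _ ↦ hτ.strictMonoOn) ⟨0, h0⟩ hmax)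
    refine ⟨γ t, ⟨htC, horb t ht⟩, fun y hy hxy ↦ ?_⟩
    obtain ⟨s, hs, rfl⟩ := hsurj y hxy
    rw [huniq s ⟨hs, hy⟩]
  choose r hr hruniq using key
  refine ⟨r, continuous_def.2 fun V hV ↦ ?_, hr, hruniq⟩
  -- By uniqueness of the intersection point, the preimage of `V` is the union of the orbits that
  -- meet `C ∩ V`.
  convert hC.1.isOpen_saturation_inter (T := T) hV using 1
  ext y
  refine ⟨fun hy ↦ ⟨r y, ⟨(hr y).1, hy⟩, (hr y).2⟩, ?_⟩
  rintro ⟨σ, ⟨hσ, hσV⟩, hyσ⟩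
  rwa [mem_preimage, ← hruniq y σ hσ hyσ]

/-- Every orbit of the time orientation meets a compact spacelike hypersurface. -/
theorem IsCauchySurface.exists_sameOrbit [ConnectedSpace M] {τ : M → ℝ} (hτ : IsTimeFunction T τ)
    {C S : Set M} (hC : IsCauchySurface g C) (hS : IsSpacelikeHypersurface g S)
    (hcomp : IsCompact S) (hne : S.Nonempty) (x : M) : ∃ σ ∈ S, SameOrbit T.field x σ := by
  obtain ⟨r, hr, hrC, huniq⟩ := hC.exists_projection hτ
  have hsat : {y | ∃ σ ∈ S, SameOrbit T.field y σ} = r ⁻¹' (r '' S) := by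
    ext y
    constructor
    · rintro ⟨σ, hσ, h⟩
      exact ⟨σ, hσ, huniq y _ (hrC σ).1 (h.trans T.contMDiff (hrC σ).2)⟩
    · rintro ⟨σ, hσ, h⟩
      refine ⟨σ, hσ, (hrC y).2.trans T.contMDiff ?_⟩
      rw [← h]
      exact (hrC σ).2.symm
  have hclopen : IsClopen {y | ∃ σ ∈ S, SameOrbit T.field y σ} := by
    refine ⟨hsat ▸ (hcomp.image hr).isClosed.preimage hr, ?_⟩
    simpa using hS.isOpen_saturation_inter (T := T) isOpen_univ
  obtain ⟨p, hp⟩ := hne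
  have hmem : p ∈ r ⁻¹' (r '' S) := ⟨p, hp, rfl⟩
  exact eq_univ_iff_forall.1 (hclopen.eq_univ ⟨p, hsat ▸ hmem⟩) x

end Projection

end Spacetime

end

theorem propositionp {n : ℕ} {M : Type*} [TopologicalSpace M] [T2Space M]
    [SecondCountableTopology M] [ConnectedSpace M]
    [ChartedSpace (Spacetime.Model n) M] [IsManifold (𝓡 (n + 1)) ∞ M]
    (g : Spacetime.LorentzianMetric n M) (T : Spacetime.TimeOrientation g)
    (hM : ∃ S : Set M, Spacetime.IsCauchySurface g S ∧ IsCompact S)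
    (τ : M → ℝ) (hτ : Spacetime.IsCMCTimeFunction T τ)
    (S : Set M) (hS_compact : IsCompact S) (hS_nonempty : S.Nonempty)
    (hS : ∃ c : ℝ, Spacetime.HasConstantMeanCurvature T S c) :
    ∃ θ : ℝ, S = τ ⁻¹' {θ} := by
  obtain ⟨c, hc⟩ := hS
  obtain ⟨C, hC, -⟩ := hM
  have hfib := hτ.eq_of_mem_of_hasConstantMeanCurvature hS_compact hS_nonempty hc
  refine ⟨c, Subset.antisymm hfib fun q hq ↦ ?_⟩
  obtain ⟨σ, hσ, γ, a, b, hγ, s, hs, t, ht, rfl, rfl⟩ :=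
    hC.exists_sameOrbit hτ.1 hc.1 hS_compact hS_nonempty q
  -- The given point of the fiber and the point of `S` lie on one integral curve and both have
  -- `τ`-value `c`.
  have hst : s = t := (hτ.1.strictMonoOn (hs.1.trans hs.2) hγ).injOn hs ht
    (Eq.trans hq (hfib _ hσ).symm)
  exact hst ▸ hσ
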